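/- **Setting.** Let $p\ge 5$ be prime and let $\sigma$ be the $p\times p$ cyclic shift permutation matrix ($\sigma_{l,k}=1$ iff $l\equiv k+1 \bmod p$). For a row-selection function $g$, i.e. five distinct integers $g(0),\dots,g(4)\in\{0,\dots,p-1\}$, the selected-row (SR) SCB code with $r=5$ has the parity-check matrix with $5\times p$ blocks $\sigma^{g(i)\cdot j \bmod p}$ ($0\le i\le 4$, $0\le j\le p-1$). The elementary array-based (EAB) code is the case $g(i)=i$. In the Tanner graph of a parity-check matrix, an $(n_v,n_o)$ absorbing set is a set $S$ of $n_v$ variable nodes with exactly $n_o$ check nodes of odd degree into $S$, such that each $v\in S$ has strictly fewer neighbours among these than among the neighbouring check nodes of $S$ of even degree into $S$. A proposed $(n_v,n_o)$ absorbing-set graph is a bipartite graph without $4$-cycles on $n_v$ variable nodes $v_1,\dots,v_{n_v}$, whose check nodes are assigned to row groups $0,\dots,4$ so that every variable node has exactly one neighbour in each row group, and in which the set of all variable nodes is an $(n_v,n_o)$ absorbing set. Given row-group labels $a_0,\dots,a_4$ in a commutative ring $R$ (here $R=\mathbb Z$ or $\mathbb Z/p$), a cycle through variable nodes $v_{s_1},\dots,v_{s_t}$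 in which $v_{s_m}$ and $v_{s_{m+1}}$ (indices cyclic) share a check node of row group $i_m$ has the equation $\sum_{m} a_{i_m}(u_{s_{m+1}}-u_{s_m})=0$ with $u_1=0$. A cycle consistency matrix (CCM) is a matrix with $n_v-1$ columns whose rows are the coefficient vectors, in the unknowns $u_2,\dots,u_{n_v}\in R$, of finitely many cycles whose equations imply the equations of all cycles. We say that *the relevant determinants for $a$ are nonzero in $R$* if, for every proposed $(4,8)$, $(5,9)$ or $(6,8)$ absorbing-set graph, every CCM has an $(n_v-1)\times(n_v-1)$ submatrix with nonzero determinant. **Theorem.** 1. For each $(n_v,n_o)\in\{(4,8),(5,9),(6,8)\}$ the number of $(n_v,n_o)$ absorbing sets in the $r=5$ EAB code is $\Theta(p^3)$: there are constants $0<c_1\le c_2$ such that this number lies between $c_1p^3$ and $c_2p^3$ for every prime $p\ge5$. 2. For each of the pairs $(p,g)$ given by $(67,[0,1,2,4,17])$, $(73,[0,1,2,3,11])$, $(79,[0,1,2,6,7])$, $(83,[0,1,2,3,7])$, $(89,[0,1,2,4,11])$, the relevant determinants for $g$ are nonzero in $\mathbb Z$ and also nonzero modulo $p$, and the SR-SCB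 code given by $p$ and $g$ has no $(4,8)$, $(5,9)$ or $(6,8)$ absorbing sets. 3. If $g$ is any choice of five distinct nonnegative integers for which the relevant determinants are nonzero in $\mathbb Z$, then for every sufficiently large prime $p$ they are nonzero modulo $p$, and the SR-SCB code given by $p$ and $g$ has no $(4,8)$, $(5,9)$ or $(6,8)$ absorbing sets. 4. For every prime $p$ and every row-selection function $g$ for $p$, if the relevant determinants for $g$ are nonzero modulo $p$, then the SR-SCB code given by $p$ and $g$ has no $(4,8)$, $(5,9)$ or $(6,8)$ absorbing sets. -/

import Mathlib

/-! ### Circulant-based codes -/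

/-- The `p × p` circulant permutation matrix whose entry in row `l` and column `k` is `1` exactly
when `l = k + 1` modulo `p`. -/
def shiftMatrix (p : ℕ) : Matrix (ZMod p) (ZMod p) (ZMod 2) :=
  Matrix.of fun l k => if l = k + 1 then 1 else 0

/-- The parity-check matrix of the circulant-based code with exponent function `f`: the block in
row group `i` and column group `j` is the `f i j`-th power of the shift matrix. Check nodes are
labelled `(i, l)` and variable nodes are labelled `(j, k)`. -/
def circulantCode (p r c : ℕ) [NeZero p] (f : Fin r → Fin c → ℕ) :
    Matrix (Fin r × ZMod p) (Fin c × ZMod p) (ZMod 2) :=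
  Matrix.of fun x y => (shiftMatrix p ^ f x.1 y.1) x.2 y.2

/-- The selected-row separable circulant-based code with five row groups, `p` column groups and
row-selection function `g`: the exponents are `g i * j` modulo `p`. -/
def srCode (p : ℕ) [NeZero p] (g : Fin 5 → ℕ) :
    Matrix (Fin 5 × ZMod p) (Fin p × ZMod p) (ZMod 2) :=
  circulantCode p 5 p fun i j => (g i * (j : ℕ)) % p

/-- The elementary array-based code with five row groups. -/
def eabCode (p : ℕ) [NeZero p] : Matrix (Fin 5 × ZMod p) (Fin p × ZMod p) (ZMod 2) :=
  srCode p fun i => (i : ℕ)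

/-! ### Absorbing sets

A binary matrix `H` is viewed as a bipartite graph between its rows (check nodes) and its columns
(variable nodes), with an edge for every nonzero entry. -/

section Absorbing

variable {F V : Type} [Fintype F] (H : Matrix F V (ZMod 2)) (S : Finset V)

/-- The number of neighbours that the check node `c` has in `S`. -/
def checkDegree (c : F) : ℕ := (S.filter fun v => H c v ≠ 0).card

/-- The neighbours of `S` of odd degree (unsatisfied check nodes). -/
def oddChecks : Finset F := Finset.univ.filter fun c => Odd (checkDegree H S c)

/-- The neighbours of `S` of even degree (satisfied check nodes). -/
def evenChecks : Finset F :=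
  Finset.univ.filter fun c => 0 < checkDegree H S c ∧ Even (checkDegree H S c)

/-- `S` is an `(nv, no)` absorbing set of the bipartite graph of `H`. -/
def IsAbsorbingSet (nv no : ℕ) : Prop :=
  S.card = nv ∧ (oddChecks H S).card = no ∧
    ∀ v ∈ S, ((oddChecks H S).filter fun c => H c v ≠ 0).card <
      ((evenChecks H S).filter fun c => H c v ≠ 0).card

end Absorbing

/-- The number of `(nv, no)` absorbing sets of the bipartite graph of `H`. -/
noncomputable def numAbsorbingSets {F V : Type} [Fintype F] (H : Matrix F V (ZMod 2))
    (nv no : ℕ) : ℕ :=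
  {S : Finset V | IsAbsorbingSet H S nv no}.ncard

/-- The parameters `(nv, no)` of the absorbing sets under consideration. -/
def targetParams : List (ℕ × ℕ) := [(4, 8), (5, 9), (6, 8)]

/-- No `(4,8)`, `(5,9)` or `(6,8)` absorbing set is present in the code of `H`. -/
def PrecludesTargets {F V : Type} [Fintype F] (H : Matrix F V (ZMod 2)) : Prop :=
  ∀ T ∈ targetParams, ∀ S : Finset V, ¬ IsAbsorbingSet H S T.1 T.2

/-! ### Proposed absorbing-set graphs and their cycle consistency matrices -/

/-- A proposed bipartite graph on `n` variable nodes whose check nodes carry row-group labels.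
Each variable node has one neighbouring check node in each of the five row groups (so the row-group
labels at a variable node are distinct): the neighbour of `v` in row group `i` is the check node
`(i, nbr v i)`; at most `n` check nodes in a row group are needed. There are no cycles of
length four. -/
structure LabelledGraph (n : ℕ) where
  nbr : Fin n → Fin 5 → Fin n
  no_four_cycle : ∀ v w : Fin n, v ≠ w → ∀ i i' : Fin 5,
    nbr v i = nbr w i → nbr v i' = nbr w i' → i = i'

namespace LabelledGraph

variable {n : ℕ} (G : LabelledGraph n)

/-- The check-by-variable incidence matrix of the graph. -/
def incidence : Matrix (Fin 5 × Fin n) (Fin n) (ZMod 2) :=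
  Matrix.of fun c v => if G.nbr v c.1 = c.2 then 1 else 0

/-- A cycle of length `2 * len` in the bipartite graph: the distinct variable nodes
`var 0, var 1, …` and distinct check nodes, where the `m`-th check node lies in row group `row m`
and joins `var m` to the cyclically next variable node. -/
structure Cycle where
  len : ℕ
  two_le : 2 ≤ len
  var : Fin len → Fin n
  row : Fin len → Fin 5
  var_injective : Function.Injective var
  check_injective : Function.Injective fun m => (row m, G.nbr (var m) (row m))
  joins : ∀ m, G.nbr (var m) (row m) = G.nbr (var (finRotate len m)) (row m)

end LabelledGraph

/-- The variable nodes other than the first one. They index the entries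
`u_v = j_v - j_first` of the vector of column-group differences. -/
abbrev NonFirst (n : ℕ) : Type := {v : Fin n // (v : ℕ) ≠ 0}

namespace LabelledGraph

variable {n : ℕ} {G : LabelledGraph n} {R : Type} [CommRing R]

/-- The coefficient of `u_w` in the cycle consistency equation
`∑ m, a (row m) * (j (var (m + 1)) - j (var m)) = 0`, where row group `i` of the graph is the row
group `a i` of the mother matrix. -/
def Cycle.coeff (C : G.Cycle) (a : Fin 5 → R) (w : NonFirst n) : R :=
  ∑ m : Fin C.len, a (C.row m) *
    ((if C.var (finRotate C.len m) = w.1 then 1 else 0) - (if C.var m = w.1 then 1 else 0))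

/-- The matrix with one row for each of the listed cycles, holding the coefficients of `u` in the
cycle consistency equation. -/
def cycleMatrix (a : Fin 5 → R) {m : ℕ} (c : Fin m → G.Cycle) : Matrix (Fin m) (NonFirst n) R :=
  Matrix.of fun l w => (c l).coeff a w

/-- The listed cycles give a cycle consistency matrix `M`: the equation `M u = 0` forces every
cycle of the graph to satisfy its cycle consistency equation. -/
def IsCCM (a : Fin 5 → R) {m : ℕ} (c : Fin m → G.Cycle) : Prop :=
  ∀ u : NonFirst n → R, (cycleMatrix a c).mulVec u = 0 →
    ∀ C : G.Cycle, ∑ w, C.coeff a w * u w = 0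

end LabelledGraph

/-- With the row-group labels `a`, the relevant determinants are nonzero: for every proposed
`(4,8)`, `(5,9)` or `(6,8)` absorbing-set graph, every cycle consistency matrix has a square
submatrix, containing all of its columns, with nonzero determinant. (If the cycle consistency matrix
is itself square, this says that its determinant is nonzero.) -/
def RelevantDetsNonzero {R : Type} [CommRing R] (a : Fin 5 → R) : Prop :=
  ∀ T ∈ targetParams, ∀ G : LabelledGraph T.1,
    IsAbsorbingSet G.incidence Finset.univ T.1 T.2 →
      ∀ (m : ℕ) (c : Fin m → G.Cycle), LabelledGraph.IsCCM a c →
        ∃ e : NonFirst T.1 → Fin m, ((LabelledGraph.cycleMatrix a c).submatrix e id).det ≠ 0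

/-- Examples of a prime together with a row-selection function. -/
def rsfTable : List (ℕ × (Fin 5 → ℕ)) :=
  [(67, ![0, 1, 2, 4, 17]), (73, ![0, 1, 2, 3, 11]), (79, ![0, 1, 2, 6, 7]),
    (83, ![0, 1, 2, 3, 7]), (89, ![0, 1, 2, 4, 11])]

/-! Over a domain, the determinant condition says that every proposed graph is rigid: only `u = 0`
satisfies all cycle equations (`relevantDetsNonzero_iff`). All cycles together form a CCM, and a
matrix with trivial kernel has a nonzero maximal minor. The column differences of an absorbing set
in a code satisfy all cycle equations. Rigidity puts all its nodes in one column group, but distinct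
nodes of a column group share no check node, so there is no such set
(`RelevantDetsNonzero.precludesTargets`). An integer minor stays nonzero modulo large primes, and
there are finitely many graphs, hence the statement for large `p`.

The table and the upper bound rest on one combinatorial fact, `IsAbsorbingPattern.hasWheel`: every
target configuration contains a wheel with three or four spokes, and every other node forms a
triangle with two nodes of the wheel. Write `X i` for the difference of `u` between rim node `i` and
the hub. The triangles of the wheel give `(a (r i) - a (s i)) * X i = (a (r i) - a (s (i + 1))) * X
(i + 1)`. Going once around the rim, a nonzero solution forces two products of label differences to
agree. `NonResonant` excludes this, and for the table it is a finite computation modulo `p`; the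
integer statement follows because a minor that is nonzero modulo `p` is nonzero.

For the order `p ^ 3`, a node is the intersection of any two of its check nodes. Hence a
configuration with given incidences is determined by the hub (`p ^ 2` choices) and one rim node
sharing a check node with it (`p` choices). Conversely, translations and dilations of one explicit
configuration give `p ^ 2 * (p - 1)` images, each set arising boundedly often. -/

/-! ### Minors of matrices with trivial kernel -/

/-- A matrix over a field whose kernel is trivial has a nonzero maximal minor. -/
theorem exists_submatrix_det_ne_zero_of_field {K m N : Type} [Field K] [Fintype m] [Fintype N]
    [DecidableEq N] (M : Matrix m N K) (h : LinearIndependent K M.col) :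
    ∃ e : N → m, (M.submatrix e id).det ≠ 0 := by
  classical
  -- Full column rank equals row rank, so the rows span and a basis can be extracted from them.
  have hr : M.rank = Fintype.card N := by
    rw [Matrix.rank_eq_finrank_span_cols]
    exact finrank_span_eq_card h
  have hspan : Submodule.span K (Set.range M.row) = ⊤ := by
    apply Submodule.eq_top_of_finrank_eq
    rw [← Matrix.rank_eq_finrank_span_row, hr, Module.finrank_fintype_fun_eq_card]
  obtain ⟨κ, f, hf, hs, hli⟩ := exists_linearIndependent' K M.row
  have hb : ⊤ ≤ Submodule.span K (Set.range (M.row ∘ f)) := by rw [hs, hspan]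
  let b := Module.Basis.mk hli hb
  let b' := Pi.basisFun K N
  let e := b'.indexEquiv b
  refine ⟨f ∘ e, ?_⟩
  have : LinearIndependent K (M.submatrix (f ∘ e) id).row := hli.comp e e.injective
  exact (Matrix.isUnit_iff_isUnit_det _).1
    (Matrix.linearIndependent_rows_iff_isUnit.1 this) |>.ne_zero

/-- A matrix over a domain whose kernel is trivial has a nonzero maximal minor. -/
theorem exists_submatrix_det_ne_zero {R m N : Type} [CommRing R] [IsDomain R] [Fintype m]
    [Fintype N] [DecidableEq N] (M : Matrix m N R) (h : ∀ u, M.mulVec u = 0 → u = 0) :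
    ∃ e : N → m, (M.submatrix e id).det ≠ 0 := by
  classical
  let K := FractionRing R
  have h1 : LinearIndependent R M.col := by
    rw [← Matrix.mulVec_injective_iff]
    exact (injective_iff_map_eq_zero M.mulVecLin).2 h
  have h2 : LinearIndependent K (M.map (algebraMap R K)).col := by
    have h3 : LinearIndependent R (M.map (algebraMap R K)).col := by
      have := h1.map' ((Algebra.linearMap R K).compLeft m) (by
        rw [LinearMap.ker_eq_bot]
        intro x y hxy
        funext i
        exact IsFractionRing.injective R K (congrFun hxy i))
      exact this
    exact (LinearIndependent.iff_fractionRing R K).1 h3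
  obtain ⟨e, he⟩ := exists_submatrix_det_ne_zero_of_field _ h2
  refine ⟨e, fun h0 => he ?_⟩
  have := congrArg (algebraMap R K) h0
  rw [RingHom.map_det, map_zero] at this
  exact this

/-! ### Cycle consistency matrices -/

namespace LabelledGraph

variable {n : ℕ} {G : LabelledGraph n} {R : Type} [CommRing R]

theorem Cycle.len_le (C : G.Cycle) : C.len ≤ n := by
  simpa using Fintype.card_le_of_injective C.var C.var_injective

/-- A cycle is given by its two node functions, and its length is at most `n`. Finiteness is what
allows listing all cycles in one CCM. -/
instance : Finite G.Cycle := by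
  let f : G.Cycle → Σ l : Fin (n + 1), (Fin l → Fin n) × (Fin l → Fin 5) := fun C =>
    ⟨⟨C.len, Nat.lt_succ_of_le C.len_le⟩, C.var, C.row⟩
  refine Finite.of_injective f ?_
  rintro ⟨l, h1, v, r, h2, h3, h4⟩ ⟨l', h1', v', r', h2', h3', h4'⟩ h
  simp only [f, Sigma.mk.injEq, Fin.mk.injEq] at h
  obtain ⟨rfl, h⟩ := h
  simp only [heq_eq_eq, Prod.mk.injEq] at h
  obtain ⟨rfl, rfl⟩ := h
  rfl

instance : Finite (LabelledGraph n) :=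
  Finite.of_injective LabelledGraph.nbr fun G G' h => by cases G; cases G'; simpa using h

variable (G) in
theorem exists_surjective_cycles : ∃ (m : ℕ) (c : Fin m → G.Cycle), Function.Surjective c := by
  obtain ⟨m, ⟨e⟩⟩ := Finite.exists_equiv_fin G.Cycle
  exact ⟨m, e.symm, e.symm.surjective⟩

variable (G) in
/-- Only the zero vector satisfies the consistency equations of all cycles. -/
def CycleRigid (a : Fin 5 → R) : Prop :=
  ∀ u : NonFirst n → R, (∀ C : G.Cycle, ∑ w, C.coeff a w * u w = 0) → u = 0

theorem mulVec_cycleMatrix (a : Fin 5 → R) {m : ℕ} (c : Fin m → G.Cycle) (u : NonFirst n → R)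
    (l : Fin m) : (cycleMatrix a c).mulVec u l = ∑ w, (c l).coeff a w * u w := rfl

theorem isCCM_of_surjective (a : Fin 5 → R) {m : ℕ} {c : Fin m → G.Cycle}
    (hc : Function.Surjective c) : IsCCM a c := by
  intro u hu C
  obtain ⟨l, rfl⟩ := hc C
  rw [← mulVec_cycleMatrix, hu, Pi.zero_apply]

theorem cycleRigid_of_det_ne_zero [IsDomain R] {a : Fin 5 → R} {m : ℕ} {c : Fin m → G.Cycle}
    {e : NonFirst n → Fin m} (he : ((cycleMatrix a c).submatrix e id).det ≠ 0) :
    G.CycleRigid a := by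
  intro u hu
  apply Matrix.eq_zero_of_mulVec_eq_zero he
  funext l
  exact hu (c (e l))

theorem CycleRigid.exists_det_ne_zero [IsDomain R] {a : Fin 5 → R} (h : G.CycleRigid a) {m : ℕ}
    {c : Fin m → G.Cycle} (hc : IsCCM a c) :
    ∃ e : NonFirst n → Fin m, ((cycleMatrix a c).submatrix e id).det ≠ 0 :=
  exists_submatrix_det_ne_zero _ fun u hu => h u (hc u hu)

theorem Cycle.map_coeff {S : Type} [CommRing S] (f : R →+* S) (C : G.Cycle) (a : Fin 5 → R)
    (w : NonFirst n) : f (C.coeff a w) = C.coeff (fun i => f (a i)) w := by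
  simp [Cycle.coeff, apply_ite f]

theorem map_det_cycleMatrix {S : Type} [CommRing S] (f : R →+* S) (a : Fin 5 → R) {m : ℕ}
    (c : Fin m → G.Cycle) (e : NonFirst n → Fin m) :
    f ((cycleMatrix a c).submatrix e id).det =
      ((cycleMatrix (fun i => f (a i)) c).submatrix e id).det := by
  rw [RingHom.map_det]
  congr 1
  ext i j
  exact Cycle.map_coeff f _ a j

/-- Rigidity is witnessed by a minor, and a minor with nonzero image under `f` is itself nonzero. -/
theorem CycleRigid.of_map {S : Type} [CommRing S] [IsDomain R] [IsDomain S] (f : R →+* S)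
    {a : Fin 5 → R} (h : G.CycleRigid fun i => f (a i)) : G.CycleRigid a := by
  obtain ⟨m, c, hc⟩ := G.exists_surjective_cycles
  obtain ⟨e, he⟩ := h.exists_det_ne_zero (isCCM_of_surjective _ hc)
  refine cycleRigid_of_det_ne_zero (c := c) (e := e) fun h0 => he ?_
  rw [← map_det_cycleMatrix, h0, map_zero]

/-- A graph which is rigid over the integers is rigid modulo all large primes. -/
theorem CycleRigid.eventually_mod_prime {g : Fin 5 → ℕ} (h : G.CycleRigid fun i => (g i : ℤ)) :
    ∃ P : ℕ, ∀ (p : ℕ) [Fact p.Prime], P ≤ p → G.CycleRigid fun i => (g i : ZMod p) := by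
  obtain ⟨m, c, hc⟩ := G.exists_surjective_cycles
  obtain ⟨e, he⟩ := h.exists_det_ne_zero (isCCM_of_surjective _ hc)
  -- A number exceeding the absolute value of a nonzero integer cannot divide it.
  refine ⟨((cycleMatrix (fun i => (g i : ℤ)) c).submatrix e id).det.natAbs + 1, fun p _ hp =>
    cycleRigid_of_det_ne_zero (c := c) (e := e) fun h0 => ?_⟩
  have h1 := map_det_cycleMatrix (Int.castRingHom (ZMod p)) (fun i => (g i : ℤ)) c e
  simp only [eq_intCast, Int.cast_natCast] at h1
  rw [h0, ZMod.intCast_zmod_eq_zero_iff_dvd, Int.natCast_dvd] at h1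
  exact absurd (Nat.le_of_dvd (Int.natAbs_pos.2 he) h1) (by omega)

/-- The value at `v` of the vector of column-group differences, which vanishes at the first
variable node. -/
def extend (u : NonFirst n → R) (v : Fin n) : R := if h : (v : ℕ) ≠ 0 then u ⟨v, h⟩ else 0

theorem Cycle.sum_coeff_mul (C : G.Cycle) (a : Fin 5 → R) (u : NonFirst n → R) :
    ∑ w, C.coeff a w * u w =
      ∑ m, a (C.row m) * (extend u (C.var (finRotate C.len m)) - extend u (C.var m)) := by
  have key : ∀ v : Fin n, ∑ w : NonFirst n, (if v = w.1 then (1 : R) else 0) * u w =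
      extend u v := by
    intro v
    unfold extend
    split_ifs with h
    · rw [Finset.sum_eq_single ⟨v, h⟩]
      · simp
      · intro b _ hb
        rw [if_neg, zero_mul]
        rintro rfl
        exact hb rfl
      · simp
    · refine Finset.sum_eq_zero fun w _ => ?_
      rw [if_neg, zero_mul]
      rintro rfl
      exact h w.2
  simp_rw [Cycle.coeff, Finset.sum_mul, mul_assoc, sub_mul]
  rw [Finset.sum_comm]
  refine Finset.sum_congr rfl fun m _ => ?_
  rw [← Finset.mul_sum, Finset.sum_sub_distrib, key, key]

theorem eq_zero_of_extend_const {u : NonFirst n → R} (h : ∀ v w, extend u v = extend u w) :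
    u = 0 := by
  funext w
  have h1 := h w.1 ⟨0, lt_of_le_of_lt (Nat.zero_le _) w.1.2⟩
  simpa [extend, w.2] using h1

/-- The consistency equation of a triangle. -/
theorem triangle_equation {a : Fin 5 → R} {u : NonFirst n → R}
    (hu : ∀ C : G.Cycle, ∑ w, C.coeff a w * u w = 0) {x y z : Fin n} {b c d : Fin 5}
    (hxy : x ≠ y) (hyz : y ≠ z) (hxz : x ≠ z) (hb : G.nbr x b = G.nbr y b)
    (hd : G.nbr y d = G.nbr z d) (hc : G.nbr x c = G.nbr z c) (hbc : b ≠ c) (hbd : b ≠ d)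
    (hcd : c ≠ d) :
    a b * (extend u y - extend u x) + a d * (extend u z - extend u y) +
      a c * (extend u x - extend u z) = 0 := by
  have h := hu
    { len := 3
      two_le := by norm_num
      var := ![x, y, z]
      row := ![b, d, c]
      var_injective := by
        intro i j
        fin_cases i <;> fin_cases j <;> simp [hxy, hyz, hxz, hxy.symm, hyz.symm, hxz.symm]
      check_injective := by
        intro i j
        fin_cases i <;> fin_cases j <;> simp [hbc, hbd, hcd, hbc.symm, hbd.symm, hcd.symm]
      joins := by
        intro m
        fin_cases m
        · exact hb
        · exact hd
        · exact hc.symm }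
  rw [Cycle.sum_coeff_mul] at h
  rw [Fin.sum_univ_three] at h
  exact h

end LabelledGraph

/-- Removes the choice of CCM: one direction applies the condition to the list of all cycles, the
other uses that every CCM of a rigid graph has trivial kernel. -/
theorem relevantDetsNonzero_iff {R : Type} [CommRing R] [IsDomain R] (a : Fin 5 → R) :
    RelevantDetsNonzero a ↔ ∀ T ∈ targetParams, ∀ G : LabelledGraph T.1,
      IsAbsorbingSet G.incidence Finset.univ T.1 T.2 → G.CycleRigid a := by
  constructor
  · intro h T hT G hG
    obtain ⟨m, c, hc⟩ := G.exists_surjective_cycles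
    obtain ⟨e, he⟩ := h T hT G hG m c (LabelledGraph.isCCM_of_surjective a hc)
    exact LabelledGraph.cycleRigid_of_det_ne_zero he
  · intro h T hT G hG m c hc
    exact (h T hT G hG).exists_det_ne_zero hc

theorem RelevantDetsNonzero.of_mod_prime {p : ℕ} [Fact p.Prime] {g : Fin 5 → ℕ}
    (h : RelevantDetsNonzero fun i => (g i : ZMod p)) :
    RelevantDetsNonzero fun i => (g i : ℤ) := by
  rw [relevantDetsNonzero_iff] at h ⊢
  intro T hT G hG
  apply LabelledGraph.CycleRigid.of_map (Int.castRingHom (ZMod p))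
  simpa using h T hT G hG

theorem RelevantDetsNonzero.eventually_mod_prime {g : Fin 5 → ℕ}
    (h : RelevantDetsNonzero fun i => (g i : ℤ)) :
    ∃ P : ℕ, ∀ (p : ℕ) [Fact p.Prime], P ≤ p → RelevantDetsNonzero fun i => (g i : ZMod p) := by
  rw [relevantDetsNonzero_iff] at h
  have h1 : ∀ T ∈ targetParams, ∃ P : ℕ, ∀ G : LabelledGraph T.1,
      IsAbsorbingSet G.incidence Finset.univ T.1 T.2 → ∀ (p : ℕ) [Fact p.Prime], P ≤ p →
        G.CycleRigid fun i => (g i : ZMod p) := by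
    intro T hT
    have h2 : ∀ G : LabelledGraph T.1, ∃ P : ℕ,
        IsAbsorbingSet G.incidence Finset.univ T.1 T.2 → ∀ (p : ℕ) [Fact p.Prime], P ≤ p →
          G.CycleRigid fun i => (g i : ZMod p) := by
      intro G
      by_cases hG : IsAbsorbingSet G.incidence Finset.univ T.1 T.2
      · obtain ⟨P, hP⟩ := (h T hT G hG).eventually_mod_prime
        exact ⟨P, fun _ => hP⟩
      · exact ⟨0, fun hG' => absurd hG' hG⟩
    -- There are finitely many labelled graphs on a given vertex set, so the individual bounds have
    -- a common one.
    choose P hP using h2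
    obtain ⟨B, hB⟩ := (Set.finite_range P).bddAbove
    exact ⟨B, fun G hG p _ hp => hP G hG p ((hB ⟨G, rfl⟩).trans hp)⟩
  choose! P hP using h1
  refine ⟨(targetParams.map P).sum, fun p _ hp => ?_⟩
  rw [relevantDetsNonzero_iff]
  intro T hT G hG
  refine hP T hT G hG p (le_trans ?_ hp)
  exact List.single_le_sum (by simp) _ (List.mem_map_of_mem hT)

/-! ### Incidence patterns

A family `ν : V → Fin 5 → X` describes the incidences of the variable nodes in `V`: the neighbour of
`v` in row group `i` is the check node `(i, ν v i)`. -/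

section Pattern

variable {n : ℕ} {X : Type} [DecidableEq X]

/-- The number of variable nodes which share the check node of `v` in row group `i`. -/
def classCard (ν : Fin n → Fin 5 → X) (v : Fin n) (i : Fin 5) : ℕ :=
  (Finset.univ.filter fun w => ν w i = ν v i).card

/-- The variable nodes with the incidences `ν` form an `(n, no)` absorbing set. -/
def IsAbsorbingPattern (ν : Fin n → Fin 5 → X) (no : ℕ) : Prop :=
  ((Finset.univ.filter fun x : Fin n × Fin 5 => Odd (classCard ν x.1 x.2)).image
      fun x => (x.2, ν x.1 x.2)).card = no ∧
    ∀ v, (Finset.univ.filter fun i => Odd (classCard ν v i)).card <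
      (Finset.univ.filter fun i => Even (classCard ν v i)).card

instance (ν : Fin n → Fin 5 → X) (no : ℕ) : Decidable (IsAbsorbingPattern ν no) := by
  unfold IsAbsorbingPattern; infer_instance

/-- Distinct variable nodes share at most one check node. -/
def NoFourCycle (ν : Fin n → Fin 5 → X) : Prop :=
  ∀ v w, v ≠ w → ∀ i i', ν v i = ν w i → ν v i' = ν w i' → i = i'

theorem classCard_congr {Y : Type} [DecidableEq Y] {ν : Fin n → Fin 5 → X}
    {μ : Fin n → Fin 5 → Y} (h : ∀ v w i, ν v i = ν w i ↔ μ v i = μ w i) (v : Fin n) (i : Fin 5) :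
    classCard ν v i = classCard μ v i := by
  simp only [classCard, h]

/-- Both images are in bijection with the image of `s` under the pair `(f, g)`. -/
theorem card_image_eq_of_forall_iff {α β γ : Type} [DecidableEq β] [DecidableEq γ] (s : Finset α)
    (f : α → β) (g : α → γ) (h : ∀ a b, f a = f b ↔ g a = g b) :
    (s.image f).card = (s.image g).card := by
  have hf : ((s.image fun a => (f a, g a)).image Prod.fst).card =
      (s.image fun a => (f a, g a)).card := by
    apply Finset.card_image_of_injOn
    simp only [Set.InjOn, Finset.coe_image, Set.mem_image, Finset.mem_coe]
    rintro _ ⟨a, -, rfl⟩ _ ⟨b, -, rfl⟩ hab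
    exact Prod.ext hab ((h a b).1 hab)
  have hg : ((s.image fun a => (f a, g a)).image Prod.snd).card =
      (s.image fun a => (f a, g a)).card := by
    apply Finset.card_image_of_injOn
    simp only [Set.InjOn, Finset.coe_image, Set.mem_image, Finset.mem_coe]
    rintro _ ⟨a, -, rfl⟩ _ ⟨b, -, rfl⟩ hab
    exact Prod.ext ((h a b).2 hab) hab
  rw [Finset.image_image] at hf hg
  exact hf.trans hg.symm

theorem IsAbsorbingPattern.congr {Y : Type} [DecidableEq Y] {ν : Fin n → Fin 5 → X}
    {μ : Fin n → Fin 5 → Y} (h : ∀ v w i, ν v i = ν w i ↔ μ v i = μ w i) {no : ℕ}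
    (hν : IsAbsorbingPattern ν no) : IsAbsorbingPattern μ no := by
  have h' := classCard_congr h
  refine ⟨?_, fun v => by simpa only [h'] using hν.2 v⟩
  rw [← hν.1]
  simp only [h']
  refine card_image_eq_of_forall_iff _ _ _ fun a b => ?_
  simp only [Prod.mk.injEq]
  constructor
  · rintro ⟨h1, h2⟩
    exact ⟨h1, by rw [← h1] at h2 ⊢; exact (h _ _ _).2 h2⟩
  · rintro ⟨h1, h2⟩
    exact ⟨h1, by rw [← h1] at h2 ⊢; exact (h _ _ _).1 h2⟩

end Pattern

/-! ### Absorbing sets as incidence patterns, and patterns as labelled graphs. -/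

section Transfer

variable {n : ℕ} {X V : Type} {H : Matrix (Fin 5 × X) V (ZMod 2)}
  {N : V → Fin 5 → X}

theorem checkDegree_map [DecidableEq X] [Fintype X] (hH : ∀ i x v, H (i, x) v ≠ 0 ↔ N v i = x)
    (q : Fin n ↪ V) (i : Fin 5) (x : X) : checkDegree H (Finset.univ.map q) (i, x) =
      (Finset.univ.filter fun w => N (q w) i = x).card := by
  simp only [checkDegree, Finset.filter_map, Finset.card_map, Function.comp_def, hH]

/-- Whether a set of variable nodes is absorbing is determined by its incidence pattern. -/
theorem isAbsorbingSet_map_iff [DecidableEq X] [Fintype X]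
    (hH : ∀ i x v, H (i, x) v ≠ 0 ↔ N v i = x) (q : Fin n ↪ V)
    (no : ℕ) : IsAbsorbingSet H (Finset.univ.map q) n no ↔
      IsAbsorbingPattern (fun v => N (q v)) no := by
  classical
  have hd : ∀ v i, checkDegree H (Finset.univ.map q) (i, N (q v) i) =
      classCard (fun v => N (q v)) v i := fun v i => checkDegree_map hH q i _
  have ho : oddChecks H (Finset.univ.map q) =
      (Finset.univ.filter fun x : Fin n × Fin 5 =>
        Odd (classCard (fun v => N (q v)) x.1 x.2)).image fun x => (x.2, N (q x.1) x.2) := by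
    ext ⟨i, x⟩
    simp only [oddChecks, Finset.mem_filter, Finset.mem_univ, true_and, Finset.mem_image,
      Prod.exists, Prod.mk.injEq]
    constructor
    · intro h
      obtain ⟨w, hw⟩ := Finset.card_pos.1 ((checkDegree_map hH q i x) ▸ h.pos)
      obtain rfl := (Finset.mem_filter.1 hw).2
      exact ⟨w, i, hd w i ▸ h, rfl, rfl⟩
    · rintro ⟨w, i, h, rfl, rfl⟩
      exact (hd w i).symm ▸ h
  have hov : ∀ v, ((oddChecks H (Finset.univ.map q)).filter fun c => H c (q v) ≠ 0).card =
      (Finset.univ.filter fun i => Odd (classCard (fun v => N (q v)) v i)).card := by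
    intro v
    rw [← Finset.card_image_of_injective (f := fun i => (i, N (q v) i)) _
      fun i j h => (Prod.mk.inj h).1]
    congr 1
    ext ⟨i, x⟩
    simp only [oddChecks, Finset.mem_filter, Finset.mem_univ, true_and, Finset.mem_image,
      Prod.mk.injEq, hH]
    constructor
    · rintro ⟨h, rfl⟩
      exact ⟨i, hd v i ▸ h, rfl, rfl⟩
    · rintro ⟨i, h, rfl, rfl⟩
      exact ⟨(hd v i).symm ▸ h, rfl⟩
  have hev : ∀ v, ((evenChecks H (Finset.univ.map q)).filter fun c => H c (q v) ≠ 0).card =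
      (Finset.univ.filter fun i => Even (classCard (fun v => N (q v)) v i)).card := by
    intro v
    rw [← Finset.card_image_of_injective (f := fun i => (i, N (q v) i)) _
      fun i j h => (Prod.mk.inj h).1]
    congr 1
    ext ⟨i, x⟩
    simp only [evenChecks, Finset.mem_filter, Finset.mem_univ, true_and, Finset.mem_image,
      Prod.mk.injEq, hH]
    constructor
    · rintro ⟨⟨_, h⟩, rfl⟩
      exact ⟨i, hd v i ▸ h, rfl, rfl⟩
    · rintro ⟨i, h, rfl, rfl⟩
      refine ⟨⟨?_, (hd v i).symm ▸ h⟩, rfl⟩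
      rw [hd]
      exact Finset.card_pos.2 ⟨v, by simp⟩
  simp only [IsAbsorbingSet, IsAbsorbingPattern, Finset.card_map, Finset.card_univ,
    Fintype.card_fin, true_and, ← ho, Finset.forall_mem_map, Finset.mem_univ, forall_const, hov,
    hev]

theorem IsAbsorbingSet.exists_embedding {F : Type} [Fintype F] {H : Matrix F V (ZMod 2)}
    {S : Finset V} {nv no : ℕ} (h : IsAbsorbingSet H S nv no) :
    ∃ q : Fin nv ↪ V, Finset.univ.map q = S := by
  obtain ⟨h, -⟩ := h
  subst h
  refine ⟨S.equivFin.symm.toEmbedding.trans (Function.Embedding.subtype _), ?_⟩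
  ext v
  simp only [Finset.mem_map, Finset.mem_univ, true_and, Function.Embedding.trans_apply,
    Equiv.coe_toEmbedding, Function.Embedding.subtype_apply]
  constructor
  · rintro ⟨a, rfl⟩
    exact (S.equivFin.symm a).2
  · intro hv
    exact ⟨S.equivFin ⟨v, hv⟩, by simp⟩

theorem LabelledGraph.incidence_ne_zero (G : LabelledGraph n) (i : Fin 5) (x v : Fin n) :
    G.incidence (i, x) v ≠ 0 ↔ G.nbr v i = x := by
  simp [LabelledGraph.incidence]

theorem LabelledGraph.isAbsorbingSet_iff (G : LabelledGraph n) (no : ℕ) :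
    IsAbsorbingSet G.incidence Finset.univ n no ↔ IsAbsorbingPattern G.nbr no := by
  have h := isAbsorbingSet_map_iff G.incidence_ne_zero (Function.Embedding.refl (Fin n)) no
  rwa [Finset.map_refl] at h

/-- Every incidence pattern without four-cycles is that of a labelled graph. -/
theorem NoFourCycle.exists_labelledGraph {ν : Fin n → Fin 5 → X} (h : NoFourCycle ν) :
    ∃ G : LabelledGraph n, ∀ v w i, ν v i = ν w i ↔ G.nbr v i = G.nbr w i := by
  -- Each check node is named after a chosen variable node on it, so `n` names per row group
  -- suffice.
  have key : ∀ v w i, ν v i = ν w i ↔ (Quotient.mk (Setoid.ker fun v => ν v i) v).out =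
      (Quotient.mk (Setoid.ker fun v => ν v i) w).out := by
    intro v w i
    rw [Quotient.out_inj, Quotient.eq]
    rfl
  exact ⟨⟨fun v i => (Quotient.mk (Setoid.ker fun v => ν v i) v).out, fun v w hvw i i' h1 h2 =>
    h v w hvw i i' ((key _ _ _).2 h1) ((key _ _ _).2 h2)⟩, key⟩

end Transfer

/-! ### Separable circulant-based codes -/

section Code

variable {p : ℕ}

theorem shiftMatrix_pow_apply [NeZero p] (m : ℕ) (l k : ZMod p) :
    (shiftMatrix p ^ m) l k = if l = k + m then 1 else 0 := by
  induction m generalizing l with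
  | zero => simp [Matrix.one_apply]
  | succ m ih =>
    rw [pow_succ', Matrix.mul_apply, Finset.sum_eq_single (k + m)]
    · rw [ih, if_pos rfl, mul_one]
      simp [shiftMatrix, add_assoc]
    · intro b _ hb
      rw [ih, if_neg hb, mul_zero]
    · simp

/-- The check node of the variable node `v` in row group `i`. -/
def codeLine (g : Fin 5 → ℕ) (v : Fin p × ZMod p) (i : Fin 5) : ZMod p :=
  v.2 + (g i : ZMod p) * ((v.1 : ℕ) : ZMod p)

theorem srCode_ne_zero [NeZero p] (g : Fin 5 → ℕ) (i : Fin 5) (x : ZMod p) (v : Fin p × ZMod p) :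
    srCode p g (i, x) v ≠ 0 ↔ codeLine g v i = x := by
  simp [srCode, circulantCode, shiftMatrix_pow_apply, codeLine, eq_comm]

theorem natCast_fin_injective [NeZero p] : Function.Injective fun j : Fin p => ((j : ℕ) : ZMod p) := by
  intro a b h
  have := (ZMod.natCast_eq_natCast_iff' _ _ _).1 h
  rw [Nat.mod_eq_of_lt a.2, Nat.mod_eq_of_lt b.2] at this
  exact Fin.ext this

/-- Check nodes of two row groups are lines of different slopes in the plane over `ZMod p`, and
these meet in one point. -/
theorem codeLine_injective [Fact p.Prime] {g : Fin 5 → ℕ}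
    (hg : Function.Injective fun i => (g i : ZMod p)) {v w : Fin p × ZMod p} {i i' : Fin 5}
    (hi : i ≠ i') (h : codeLine g v i = codeLine g w i) (h' : codeLine g v i' = codeLine g w i') :
    v = w := by
  unfold codeLine at h h'
  have h1 : ((g i : ZMod p) - g i') * (((v.1 : ℕ) : ZMod p) - ((w.1 : ℕ) : ZMod p)) = 0 := by
    linear_combination h - h'
  have h2 : ((v.1 : ℕ) : ZMod p) = ((w.1 : ℕ) : ZMod p) :=
    sub_eq_zero.1 ((mul_eq_zero.1 h1).resolve_left (sub_ne_zero.2 fun h => hi (hg h)))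
  rw [h2] at h
  exact Prod.ext (natCast_fin_injective h2) (add_right_cancel h)

theorem noFourCycle_codeLine [Fact p.Prime] {g : Fin 5 → ℕ}
    (hg : Function.Injective fun i => (g i : ZMod p)) {n : ℕ} (q : Fin n ↪ Fin p × ZMod p) :
    NoFourCycle fun v => codeLine g (q v) := by
  intro v w hvw i i' h h'
  by_contra hi
  exact hvw (q.injective (codeLine_injective hg hi h h'))

theorem natCast_comp_injective {g : Fin 5 → ℕ} (hg : Function.Injective g) (hp : ∀ i, g i < p) :
    Function.Injective fun i => (g i : ZMod p) := by
  intro a b h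
  have := (ZMod.natCast_eq_natCast_iff' _ _ _).1 h
  rw [Nat.mod_eq_of_lt (hp a), Nat.mod_eq_of_lt (hp b)] at this
  exact hg this

theorem RelevantDetsNonzero.precludesTargets [Fact p.Prime] {g : Fin 5 → ℕ}
    (hg : Function.Injective g) (hp : ∀ i, g i < p)
    (h : RelevantDetsNonzero fun i => (g i : ZMod p)) : PrecludesTargets (srCode p g) := by
  intro T hT S hS
  obtain ⟨q, rfl⟩ := hS.exists_embedding
  have hgp := natCast_comp_injective hg hp
  rw [isAbsorbingSet_map_iff (srCode_ne_zero g)] at hS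
  obtain ⟨G, hG⟩ := (noFourCycle_codeLine hgp q).exists_labelledGraph
  have hrigid := (relevantDetsNonzero_iff _).1 h T hT G
    ((G.isAbsorbingSet_iff _).2 (hS.congr hG))
  have hpos : 0 < T.1 := by
    simp only [targetParams, List.mem_cons, List.not_mem_nil, or_false] at hT
    rcases hT with rfl | rfl | rfl <;> norm_num
  let J : Fin T.1 → ZMod p := fun v => (((q v).1 : ℕ) : ZMod p)
  let u : NonFirst T.1 → ZMod p := fun w => J w.1 - J ⟨0, hpos⟩
  have hu : ∀ v, LabelledGraph.extend u v = J v - J ⟨0, hpos⟩ := by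
    intro v
    unfold LabelledGraph.extend
    split_ifs with h0
    · rfl
    · rw [show v = ⟨0, hpos⟩ from Fin.ext (not_not.1 h0), sub_self]
  have hu0 : u = 0 := by
    apply hrigid
    intro C
    rw [LabelledGraph.Cycle.sum_coeff_mul]
    -- Two nodes on a check node satisfy `g i * (j' - j) = k - k'`, so the sum around a cycle
    -- cancels.
    have : ∀ m, (g (C.row m) : ZMod p) * (LabelledGraph.extend u (C.var (finRotate C.len m)) -
        LabelledGraph.extend u (C.var m)) =
        (q (C.var m)).2 - (q (C.var (finRotate C.len m))).2 := by
      intro m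
      have h1 := (hG _ _ _).2 (C.joins m)
      simp only [codeLine] at h1
      rw [hu, hu]
      linear_combination -h1
    rw [Finset.sum_congr rfl fun m _ => this m, Finset.sum_sub_distrib,
      Equiv.sum_comp (finRotate C.len) fun m => (q (C.var m)).2, sub_self]
  have hJ : ∀ v, J v = J ⟨0, hpos⟩ := by
    intro v
    have := hu v
    rw [hu0] at this
    have h0 : LabelledGraph.extend (0 : NonFirst T.1 → ZMod p) v = 0 := by
      simp [LabelledGraph.extend]
    exact sub_eq_zero.1 (this.symm.trans h0)
  -- The first node has an even check node, hence a second node on it. Both lie in the same column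
  -- group, so they coincide.
  obtain ⟨i, hi⟩ := Finset.card_pos.1 ((Nat.zero_le _).trans_lt (hS.2 ⟨0, hpos⟩))
  have hi := (Finset.mem_filter.1 hi).2
  have h1 : 1 < classCard (fun v => codeLine g (q v)) ⟨0, hpos⟩ i := by
    have : 0 < classCard (fun v => codeLine g (q v)) ⟨0, hpos⟩ i :=
      Finset.card_pos.2 ⟨⟨0, hpos⟩, by simp⟩
    obtain ⟨k, hk⟩ := hi
    omega
  obtain ⟨w, hw, hne⟩ := Finset.exists_mem_ne h1 ⟨0, hpos⟩
  have h2 := (Finset.mem_filter.1 hw).2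
  simp only [codeLine] at h2
  have h3 : (((q w).1 : ℕ) : ZMod p) = (((q ⟨0, hpos⟩).1 : ℕ) : ZMod p) := hJ w
  rw [h3] at h2
  exact hne (q.injective (Prod.ext (natCast_fin_injective h3) (add_right_cancel h2)))

end Code

/-! ### Wheels in dense graphs on at most six vertices -/

section Wheel

variable {n : ℕ}

/-- The unordered pairs of distinct vertices, as ordered pairs. -/
def vertexPairs (n : ℕ) : List (Fin n × Fin n) :=
  (List.finRange n ×ˢ List.finRange n).filter fun e => e.1 < e.2

/-- The adjacency relation of the graph whose non-edges are listed. -/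
def adjOfNonEdges (E : List (Fin n × Fin n)) (u v : Fin n) : Bool :=
  u != v && !E.contains (u, v) && !E.contains (v, u)

/-- Every vertex outside `W` is joined to two adjacent vertices of `W`. -/
def coversBool (adj : Fin n → Fin n → Bool) (W : List (Fin n)) : Bool :=
  (List.finRange n).all fun x => W.contains x ||
    W.any fun y => adj x y && W.any fun z => adj x z && adj y z

/-- There is a wheel with three or four spokes to which all other vertices are attached. -/
def hasWheelBool (adj : Fin n → Fin n → Bool) : Bool :=
  (List.finRange n).any fun h => (List.finRange n).any fun a => adj h a &&
    (List.finRange n).any fun b => adj h b && adj a b &&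
      (List.finRange n).any fun c => adj h c && adj b c &&
        ((adj c a && coversBool adj [h, a, b, c]) ||
          (a != c && (List.finRange n).any fun d => adj h d && adj c d && adj d a && b != d &&
            coversBool adj [h, a, b, c, d]))

/-- Every vertex lies in at most `n - 4` of the listed pairs. -/
def maxDegreeBool (E : List (Fin n × Fin n)) : Bool :=
  (List.finRange n).all fun v => decide (E.countP (fun e => e.1 == v || e.2 == v) ≤ n - 4)

/-- This and the next two results search all graphs with few non-edges exhaustively. The graphs are
listed by their non-edges, at most four, two and zero in number. -/
theorem hasWheelBool_six : ∀ k ∈ List.range 5, ∀ E ∈ List.sublistsLen k (vertexPairs 6),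
    (!maxDegreeBool E || hasWheelBool (adjOfNonEdges E)) = true := by
  decide +kernel

theorem hasWheelBool_five : ∀ k ∈ List.range 3, ∀ E ∈ List.sublistsLen k (vertexPairs 5),
    (!maxDegreeBool E || hasWheelBool (adjOfNonEdges E)) = true := by
  decide +kernel

theorem hasWheelBool_four : ∀ k ∈ List.range 1, ∀ E ∈ List.sublistsLen k (vertexPairs 4),
    (!maxDegreeBool E || hasWheelBool (adjOfNonEdges E)) = true := by
  decide +kernel

theorem mem_vertexPairs {e : Fin n × Fin n} : e ∈ vertexPairs n ↔ e.1 < e.2 := by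
  obtain ⟨a, b⟩ := e
  simp [vertexPairs]

theorem nodup_vertexPairs (n : ℕ) : (vertexPairs n).Nodup :=
  ((List.nodup_finRange n).product (List.nodup_finRange n)).filter _

/-- A graph on four, five or six vertices with minimum degree at least three and at most zero, two
or four non-edges, respectively, has a wheel. -/
theorem hasWheelBool_of_card {m : ℕ} (hn : (n, m) ∈ [(4, 0), (5, 2), (6, 4)])
    {adj : Fin n → Fin n → Bool} (hsymm : ∀ u v, adj u v = adj v u) (hirr : ∀ u, adj u u = false)
    (hdeg : ∀ v, (Finset.univ.filter fun w => w ≠ v ∧ adj v w = false).card ≤ n - 4)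
    (hcard : (Finset.univ.filter fun e : Fin n × Fin n =>
      e.1 < e.2 ∧ adj e.1 e.2 = false).card ≤ m) : hasWheelBool adj = true := by
  let E := (vertexPairs n).filter fun e => !adj e.1 e.2
  have hmem : ∀ e, e ∈ E ↔ e.1 < e.2 ∧ adj e.1 e.2 = false := by
    intro e
    simp [E, mem_vertexPairs]
  have hnodup : E.Nodup := (nodup_vertexPairs n).filter _
  have hE : E.length ≤ m := by
    rw [← List.toFinset_card_of_nodup hnodup]
    refine le_trans (Finset.card_le_card fun e he => ?_) hcard
    simpa [hmem] using he
  have hadj : adjOfNonEdges E = adj := by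
    funext u v
    rw [Bool.eq_iff_iff]
    simp only [adjOfNonEdges, Bool.and_eq_true, bne_iff_ne, ne_eq, Bool.not_eq_true',
      List.contains_eq_mem, decide_eq_false_iff_not, hmem, not_and, Bool.not_eq_false]
    rcases lt_trichotomy u v with h | rfl | h
    · simp [h, h.ne, h.not_gt]
    · simp [hirr]
    · simp [h, h.ne', h.not_gt, hsymm u v]
  have hmax : maxDegreeBool E = true := by
    simp only [maxDegreeBool, List.all_eq_true, List.mem_finRange, forall_const, decide_eq_true_eq]
    intro v
    rw [List.countP_eq_length_filter, ← List.toFinset_card_of_nodup (hnodup.filter _)]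
    -- A non-edge at `v` is sent to its other endpoint.
    refine le_trans (Finset.card_le_card_of_injOn (fun e => if e.1 = v then e.2 else e.1) ?_ ?_)
      (hdeg v)
    · intro e he
      simp only [List.coe_toFinset, List.mem_filter, hmem, Set.mem_ofPred_eq, Bool.or_eq_true,
        beq_iff_eq] at he
      obtain ⟨⟨hlt, he⟩, rfl | rfl⟩ := he
      · simp [he, hlt.ne']
      · simp [hlt.ne, hsymm e.2, he]
    · intro e he e' he' h
      simp only [List.coe_toFinset, List.mem_filter, hmem, Set.mem_ofPred_eq, Bool.or_eq_true,
        beq_iff_eq] at he he'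
      obtain ⟨a, b⟩ := e
      obtain ⟨c, d⟩ := e'
      simp only at he he' h
      split_ifs at h with h1 h2 h2 <;> grind
  have key : (!maxDegreeBool E || hasWheelBool (adjOfNonEdges E)) = true := by
    have hsub : E ∈ List.sublistsLen E.length (vertexPairs n) :=
      List.mem_sublistsLen.2 ⟨List.filter_sublist, rfl⟩
    simp only [List.mem_cons, Prod.mk.injEq, List.not_mem_nil, or_false] at hn
    rcases hn with ⟨rfl, rfl⟩ | ⟨rfl, rfl⟩ | ⟨rfl, rfl⟩
    · exact hasWheelBool_four _ (List.mem_range.2 (by omega)) E hsub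
    · exact hasWheelBool_five _ (List.mem_range.2 (by omega)) E hsub
    · exact hasWheelBool_six _ (List.mem_range.2 (by omega)) E hsub
  simpa [hmax, hadj] using key

end Wheel

/-! ### Counting in absorbing patterns -/

section Count

variable {n : ℕ} {X : Type} [DecidableEq X] {ν : Fin n → Fin 5 → X}

theorem classCard_pos (ν : Fin n → Fin 5 → X) (v : Fin n) (i : Fin 5) : 0 < classCard ν v i :=
  Finset.card_pos.2 ⟨v, by simp⟩

theorem exists_ne_of_one_lt_classCard {v : Fin n} {i : Fin 5} (h : 1 < classCard ν v i) :
    ∃ w, w ≠ v ∧ ν w i = ν v i := by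
  obtain ⟨w, hw, hne⟩ := Finset.exists_mem_ne h v
  exact ⟨w, hne, (Finset.mem_filter.1 hw).2⟩

theorem one_lt_of_even_classCard {v : Fin n} {i : Fin 5} (h : Even (classCard ν v i)) :
    1 < classCard ν v i := by
  have := classCard_pos ν v i
  obtain ⟨k, hk⟩ := h
  omega

theorem IsAbsorbingPattern.three_le_card_even {no : ℕ} (h : IsAbsorbingPattern ν no) (v : Fin n) :
    3 ≤ (Finset.univ.filter fun i => Even (classCard ν v i)).card := by
  have h1 := h.2 v
  have h2 := Finset.card_filter_add_card_filter_not (s := (Finset.univ : Finset (Fin 5)))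
    (fun i => Even (classCard ν v i))
  simp only [Nat.not_even_iff_odd, Finset.card_univ, Fintype.card_fin] at h2
  omega

/-- Even check nodes of `v` lead to distinct neighbours. -/
theorem NoFourCycle.exists_injOn (hν : NoFourCycle ν) (v : Fin n) :
    ∃ f : Fin 5 → Fin n, (∀ i, Even (classCard ν v i) → f i ≠ v ∧ ν (f i) i = ν v i) ∧
      Set.InjOn f {i | Even (classCard ν v i)} := by
  have : ∀ i, ∃ w, Even (classCard ν v i) → w ≠ v ∧ ν w i = ν v i := by
    intro i
    by_cases h : Even (classCard ν v i)
    · obtain ⟨w, hw⟩ := exists_ne_of_one_lt_classCard (one_lt_of_even_classCard h)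
      exact ⟨w, fun _ => hw⟩
    · exact ⟨v, fun h' => absurd h' h⟩
  choose f hf using this
  refine ⟨f, hf, fun i hi j hj hij => ?_⟩
  refine hν (f i) v (hf i hi).1 i j (hf i hi).2 ?_
  rw [hij]
  exact (hf j hj).2

/-- The variable nodes `v` and `w` share a check node. -/
def adjBool (ν : Fin n → Fin 5 → X) (v w : Fin n) : Bool :=
  decide (v ≠ w ∧ ∃ i, ν v i = ν w i)

theorem adjBool_comm (v w : Fin n) : adjBool ν v w = adjBool ν w v := by
  simp only [adjBool, ne_comm, eq_comm]

/-- At least three of the five check nodes of `v` are even, and they lead to distinct neighbours. -/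
theorem IsAbsorbingPattern.card_nonNeighbours_le {no : ℕ} (h : IsAbsorbingPattern ν no)
    (hν : NoFourCycle ν) (v : Fin n) :
    (Finset.univ.filter fun w => w ≠ v ∧ adjBool ν v w = false).card ≤ n - 4 := by
  obtain ⟨f, hf, hinj⟩ := hν.exists_injOn v
  have h1 := h.three_le_card_even v
  have h2 : (Finset.univ.filter fun i => Even (classCard ν v i)).card ≤
      (Finset.univ.filter fun w => adjBool ν v w = true).card := by
    refine Finset.card_le_card_of_injOn f ?_ ?_
    · intro i hi
      have := hf i (by simpa using hi)
      simp only [Finset.coe_filter, Finset.mem_univ, true_and, Set.mem_ofPred_eq, adjBool,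
        decide_eq_true_eq]
      exact ⟨this.1.symm, i, this.2.symm⟩
    · simpa using hinj
  have h3 : insert v ((Finset.univ.filter fun w => w ≠ v ∧ adjBool ν v w = false) ∪
      (Finset.univ.filter fun w => adjBool ν v w = true)) ⊆ Finset.univ := Finset.subset_univ _
  have h4 := Finset.card_le_card h3
  rw [Finset.card_insert_of_notMem, Finset.card_union_of_disjoint, Finset.card_univ,
    Fintype.card_fin] at h4
  · omega
  · rw [Finset.disjoint_filter]
    rintro w - ⟨-, hw⟩
    simp [hw]
  · simp [adjBool]

/-- A check node of degree `d` at `v` leaves only `n - d` possible neighbours for the other even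
check nodes of `v`. -/
theorem NoFourCycle.card_even_ne_le (hν : NoFourCycle ν) (v : Fin n) (i : Fin 5) :
    (Finset.univ.filter fun j => Even (classCard ν v j) ∧ j ≠ i).card ≤ n - classCard ν v i := by
  obtain ⟨f, hf, hinj⟩ := hν.exists_injOn v
  have h1 : n - classCard ν v i = (Finset.univ.filter fun w => ¬ ν w i = ν v i).card := by
    have := Finset.card_filter_add_card_filter_not (s := (Finset.univ : Finset (Fin n)))
      (fun w => ν w i = ν v i)
    rw [Finset.card_univ, Fintype.card_fin] at this
    unfold classCard
    omega
  rw [h1]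
  refine Finset.card_le_card_of_injOn f ?_ ?_
  · intro j hj
    have hj : Even (classCard ν v j) ∧ j ≠ i := by simpa using hj
    simp only [Finset.coe_filter, Finset.mem_univ, true_and, Set.mem_ofPred_eq]
    intro h
    exact hj.2 (hν _ _ (hf j hj.1).1 _ _ (hf j hj.1).2 h)
  · refine hinj.mono fun j hj => ?_
    have hj : Even (classCard ν v j) ∧ j ≠ i := by simpa using hj
    exact hj.1

/-- The left side counts triples `(v, i, w)` with `w ≠ v` on the check node of `v` in row group `i`;
without four-cycles, `(v, w)` determines `i`. -/
theorem NoFourCycle.sum_classCard_le (hν : NoFourCycle ν) :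
    ∑ x : Fin n × Fin 5, (classCard ν x.1 x.2 - 1) ≤
      (Finset.univ.filter fun e : Fin n × Fin n => adjBool ν e.1 e.2 = true).card := by
  have h1 : ∀ x : Fin n × Fin 5, classCard ν x.1 x.2 - 1 =
      (Finset.univ.filter fun w => w ≠ x.1 ∧ ν w x.2 = ν x.1 x.2).card := by
    intro x
    have : (Finset.univ.filter fun w => w ≠ x.1 ∧ ν w x.2 = ν x.1 x.2) =
        (Finset.univ.filter fun w => ν w x.2 = ν x.1 x.2).erase x.1 := by
      ext w
      simp
    rw [this, Finset.card_erase_of_mem (by simp)]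
    rfl
  simp_rw [h1]
  rw [← Finset.card_sigma]
  refine Finset.card_le_card_of_injOn (fun y => (y.1.1, y.2)) ?_ ?_
  · rintro ⟨⟨v, i⟩, w⟩ hy
    simp only [Finset.coe_sigma, Set.mem_sigma_iff, Finset.mem_coe, Finset.mem_univ, true_and,
      Finset.mem_filter] at hy
    simp only [Finset.coe_filter, Finset.mem_univ, true_and, Set.mem_ofPred_eq, adjBool,
      decide_eq_true_eq]
    exact ⟨hy.1.symm, i, hy.2.symm⟩
  · rintro ⟨⟨v, i⟩, w⟩ hy ⟨⟨v', i'⟩, w'⟩ hy' h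
    simp only [Finset.coe_sigma, Set.mem_sigma_iff, Finset.mem_coe, Finset.mem_univ, true_and,
      Finset.mem_filter] at hy hy'
    simp only [Prod.mk.injEq] at h
    obtain ⟨rfl, rfl⟩ := h
    obtain rfl := hν _ _ hy.1 _ _ hy.2 hy'.2
    rfl

theorem IsAbsorbingPattern.card_classCard_eq_one_le {no : ℕ} (h : IsAbsorbingPattern ν no) :
    (Finset.univ.filter fun x : Fin n × Fin 5 => classCard ν x.1 x.2 = 1).card ≤ no := by
  rw [← h.1]
  refine Finset.card_le_card_of_injOn (fun x => (x.2, ν x.1 x.2)) ?_ ?_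
  · intro x hx
    have hx : classCard ν x.1 x.2 = 1 := by simpa using hx
    simp only [Finset.coe_image, Set.mem_image, Finset.mem_coe, Finset.mem_filter,
      Finset.mem_univ, true_and]
    exact ⟨x, hx ▸ odd_one, rfl⟩
  · rintro ⟨v, i⟩ hx ⟨w, j⟩ - hxy
    have hx : classCard ν v i = 1 := by simpa using hx
    simp only [Prod.mk.injEq] at hxy
    obtain ⟨rfl, hvw⟩ := hxy
    obtain ⟨a, ha⟩ := Finset.card_eq_one.1 hx
    have h1 : v ∈ ({a} : Finset (Fin n)) := ha ▸ by simp
    have h2 : w ∈ ({a} : Finset (Fin n)) := ha ▸ by simp [hvw]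
    rw [Finset.mem_singleton.1 h1, Finset.mem_singleton.1 h2]

/-- A lower bound for the number of ordered pairs of variable nodes which share a check node, in the
presence of a check node of degree `d`. -/
theorem IsAbsorbingPattern.le_card_adj {no : ℕ} (h : IsAbsorbingPattern ν no)
    (hν : NoFourCycle ν) (v : Fin n) (i : Fin 5) :
    5 * n + classCard ν v i * (classCard ν v i - 2) ≤
      (Finset.univ.filter fun e : Fin n × Fin n => adjBool ν e.1 e.2 = true).card + no := by
  have hline : ∀ w, ν w i = ν v i → classCard ν w i = classCard ν v i := by
    intro w hw
    simp only [classCard, hw]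
  -- Every incidence with a check node of degree at least two contributes at least one. Each of the
  -- incidences with the chosen check node contributes `classCard ν v i - 2` more.
  have h1 : ∑ x : Fin n × Fin 5, ((if classCard ν x.1 x.2 = 1 then 0 else 1) +
      if ν x.1 i = ν v i ∧ x.2 = i then classCard ν v i - 2 else 0) ≤
      ∑ x : Fin n × Fin 5, (classCard ν x.1 x.2 - 1) := by
    refine Finset.sum_le_sum fun x _ => ?_
    have := classCard_pos ν x.1 x.2
    split_ifs with h1 h2 h2
    · rw [h2.2, hline _ h2.1] at h1
      omega
    · omega
    · rw [h2.2, hline _ h2.1] at h1 this ⊢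
      omega
    · omega
  rw [Finset.sum_add_distrib, ← Finset.sum_filter, Finset.sum_const, smul_eq_mul] at h1
  have h2 : (Finset.univ.filter fun x : Fin n × Fin 5 => ν x.1 i = ν v i ∧ x.2 = i).card =
      classCard ν v i := by
    rw [classCard, ← Finset.card_image_of_injective (f := fun w : Fin n => (w, i)) _
      fun a b h => (Prod.mk.inj h).1]
    congr 1
    ext ⟨w, j⟩
    simp only [Finset.mem_filter, Finset.mem_univ, true_and, Finset.mem_image, Prod.mk.injEq]
    constructor
    · rintro ⟨h, rfl⟩
      exact ⟨w, h, rfl, rfl⟩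
    · rintro ⟨w, h, rfl, rfl⟩
      exact ⟨h, rfl⟩
  have h3 : ∑ x : Fin n × Fin 5, (if classCard ν x.1 x.2 = 1 then 0 else 1) +
      (Finset.univ.filter fun x : Fin n × Fin 5 => classCard ν x.1 x.2 = 1).card = 5 * n := by
    rw [Finset.card_filter, ← Finset.sum_add_distrib]
    rw [Finset.sum_congr rfl (g := fun _ => 1)]
    · simp [mul_comm]
    · intro x _
      split_ifs <;> rfl
  have h4 := h.card_classCard_eq_one_le
  have h5 := hν.sum_classCard_le
  rw [h2] at h1
  omega

theorem card_adj_add_card_nonAdj (ν : Fin n → Fin 5 → X) :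
    (Finset.univ.filter fun e : Fin n × Fin n => adjBool ν e.1 e.2 = true).card +
      2 * (Finset.univ.filter fun e : Fin n × Fin n =>
        e.1 < e.2 ∧ adjBool ν e.1 e.2 = false).card + n = n * n := by
  have h1 : (Finset.univ.filter fun e : Fin n × Fin n =>
      e.2 < e.1 ∧ adjBool ν e.1 e.2 = false).card =
      (Finset.univ.filter fun e : Fin n × Fin n =>
        e.1 < e.2 ∧ adjBool ν e.1 e.2 = false).card := by
    rw [← Finset.card_map (Equiv.prodComm (Fin n) (Fin n)).toEmbedding]
    congr 1
    ext ⟨a, b⟩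
    simp [adjBool_comm a b]
  have h2 : (Finset.univ.filter fun e : Fin n × Fin n => e.1 = e.2).card = n := by
    rw [Finset.univ_product_univ.symm, ← Finset.diag_eq_filter, Finset.diag_card, Finset.card_univ,
      Fintype.card_fin]
  have h3 : n * n = ∑ _e : Fin n × Fin n, 1 := by simp
  have h4 : ∑ e : Fin n × Fin n, 1 = ∑ e : Fin n × Fin n,
      ((if adjBool ν e.1 e.2 = true then 1 else 0) +
        (if e.1 < e.2 ∧ adjBool ν e.1 e.2 = false then 1 else 0) +
        (if e.2 < e.1 ∧ adjBool ν e.1 e.2 = false then 1 else 0) +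
        (if e.1 = e.2 then 1 else 0)) := by
    refine Finset.sum_congr rfl fun e _ => ?_
    rcases lt_trichotomy e.1 e.2 with h | h | h
    · cases adjBool ν e.1 e.2 <;> simp [h, h.not_gt, h.ne]
    · simp [adjBool, h]
    · cases adjBool ν e.1 e.2 <;> simp [h, h.not_gt, h.ne']
  simp only [Finset.sum_add_distrib, ← Finset.card_filter] at h4
  omega

end Count

/-! ### Wheels in absorbing patterns -/

section PatternWheel

variable {n m : ℕ} {X : Type} {ν : Fin n → Fin 5 → X}

/-- The vertices of the wheel with hub `h` and rim `v`. -/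
def wheelSet (h : Fin n) (v : Fin (m + 1) → Fin n) : Set (Fin n) := insert h (Set.range v)

/-- The hub `h` shares check nodes in the row groups `s i` with the rim vertices `v i`, and cyclically
consecutive rim vertices share check nodes in the row groups `r i`. The row groups at each vertex of
the wheel are distinct, and every other vertex shares check nodes in different row groups with
two vertices of the wheel which are neighbours. -/
structure IsWheel (ν : Fin n → Fin 5 → X) (h : Fin n) (v : Fin (m + 1) → Fin n)
    (s r : Fin (m + 1) → Fin 5) : Prop where
  hub_ne : ∀ i, h ≠ v i
  rim_injective : Function.Injective v
  hub : ∀ i, ν h (s i) = ν (v i) (s i)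
  rim : ∀ i, ν (v i) (r i) = ν (v (i + 1)) (r i)
  spoke_injective : Function.Injective s
  rim_ne_left : ∀ i, r i ≠ s i
  rim_ne_right : ∀ i, r i ≠ s (i + 1)
  rim_ne_rim : ∀ i, r i ≠ r (i + 1)
  cover : ∀ x, x ∈ wheelSet h v ∨ ∃ y ∈ wheelSet h v, ∃ z ∈ wheelSet h v, ∃ b c d, b ≠ c ∧
    ν x b = ν y b ∧ ν x c = ν z c ∧ ν y d = ν z d

/-- There is a wheel with three or four spokes. -/
def HasWheel (ν : Fin n → Fin 5 → X) : Prop :=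
  ∃ m, (m = 2 ∨ m = 3) ∧ ∃ (h : Fin n) (v : Fin (m + 1) → Fin n) (s r : Fin (m + 1) → Fin 5),
    IsWheel ν h v s r

/-- If two edges of the wheel at a common vertex had the same row group, three wheel vertices would
lie on one check node, which `hnc` forbids. So adjacency alone yields the distinctness of row groups
in `IsWheel`. -/
theorem exists_isWheel (hm : m = 2 ∨ m = 3) {h : Fin n} {v : Fin (m + 1) → Fin n}
    (hv : Function.Injective v) (hhub : ∀ i, h ≠ v i ∧ ∃ j, ν h j = ν (v i) j)
    (hrim : ∀ i, ∃ j, ν (v i) j = ν (v (i + 1)) j)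
    (hnc : ∀ x ∈ wheelSet h v, ∀ y ∈ wheelSet h v, ∀ z ∈ wheelSet h v, x ≠ y → y ≠ z → x ≠ z →
      ∀ i, ν x i = ν y i → ν y i ≠ ν z i)
    (hcover : ∀ x, x ∈ wheelSet h v ∨ ∃ y ∈ wheelSet h v, ∃ z ∈ wheelSet h v, ∃ b c d, b ≠ c ∧
      ν x b = ν y b ∧ ν x c = ν z c ∧ ν y d = ν z d) : HasWheel ν := by
  have h1 : ∀ i : Fin (m + 1), i + 1 ≠ i := by rcases hm with rfl | rfl <;> decide
  have h2 : ∀ i : Fin (m + 1), i + 1 + 1 ≠ i := by rcases hm with rfl | rfl <;> decide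
  have hh : h ∈ wheelSet h v := Set.mem_insert _ _
  have hvm : ∀ i, v i ∈ wheelSet h v := fun i => Set.mem_insert_of_mem _ ⟨i, rfl⟩
  choose hne s hs using hhub
  choose r hr using hrim
  refine ⟨m, hm, h, v, s, r, hne, hv, hs, hr, ?_, ?_, ?_, ?_, hcover⟩
  · intro i j hij
    by_contra hne'
    exact hnc _ (hvm i) _ hh _ (hvm j) (hne i).symm (hne j) (fun h => hne' (hv h)) (s i)
      (hs i).symm (hij ▸ hs j)
  · intro i hi
    exact hnc _ hh _ (hvm i) _ (hvm (i + 1)) (hne i) (fun h => h1 i (hv h).symm) (hne _) (s i)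
      (hs i) (hi ▸ hr i)
  · intro i hi
    exact hnc _ hh _ (hvm (i + 1)) _ (hvm i) (hne _) (fun h => h1 i (hv h)) (hne _) (s (i + 1))
      (hs _) (hi ▸ (hr i).symm)
  · intro i hi
    exact hnc _ (hvm i) _ (hvm (i + 1)) _ (hvm (i + 1 + 1)) (fun h => h1 i (hv h).symm)
      (fun h => h1 (i + 1) (hv h).symm) (fun h => h2 i (hv h).symm) (r i) (hr i)
      (hi ▸ hr (i + 1))

variable [DecidableEq X]

theorem adjBool_eq_true {x y : Fin n} :
    adjBool ν x y = true ↔ x ≠ y ∧ ∃ i, ν x i = ν y i := by simp [adjBool]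

/-- If no check node has degree three or more, a wheel in the adjacency graph is a wheel of the
pattern. -/
theorem hasWheel_of_hasWheelBool (hcls : ∀ v i, classCard ν v i ≤ 2)
    (h : hasWheelBool (adjBool ν) = true) : HasWheel ν := by
  have hnc : ∀ x y z : Fin n, x ≠ y → y ≠ z → x ≠ z → ∀ i, ν x i = ν y i → ν y i ≠ ν z i := by
    intro x y z hxy hyz hxz i h1 h2
    have h3 : ({x, y, z} : Finset (Fin n)).card ≤ classCard ν y i := by
      refine Finset.card_le_card fun w hw => ?_
      simp only [Finset.mem_insert, Finset.mem_singleton] at hw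
      rcases hw with rfl | rfl | rfl <;> simp [h1, h2]
    rw [Finset.card_eq_three.2 ⟨x, y, z, hxy, hxz, hyz, rfl⟩] at h3
    exact absurd (hcls y i) (by omega)
  have hcov : ∀ {W : List (Fin n)} {S : Set (Fin n)}, (∀ w, w ∈ W ↔ w ∈ S) →
      coversBool (adjBool ν) W = true → ∀ x, x ∈ S ∨ ∃ y ∈ S, ∃ z ∈ S, ∃ b c d, b ≠ c ∧
      ν x b = ν y b ∧ ν x c = ν z c ∧ ν y d = ν z d := by
    intro W S hWS hW x
    simp only [coversBool, List.all_eq_true, List.mem_finRange, forall_const, Bool.or_eq_true,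
      List.contains_eq_mem, decide_eq_true_eq, List.any_eq_true, Bool.and_eq_true,
      adjBool_eq_true] at hW
    rcases hW x with hx | ⟨y, hy, ⟨hxy, b, hb⟩, z, hz, ⟨hxz, c, hc⟩, hyz, d, hd⟩
    · exact Or.inl ((hWS x).1 hx)
    · refine Or.inr ⟨y, (hWS y).1 hy, z, (hWS z).1 hz, b, c, d, ?_, hb, hc, hd⟩
      rintro rfl
      exact hnc y x z hxy.symm hxz hyz b hb.symm hc
  simp only [hasWheelBool, List.any_eq_true, List.mem_finRange, true_and, Bool.and_eq_true,
    Bool.or_eq_true, adjBool_eq_true, bne_iff_ne] at h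
  obtain ⟨o, a, ⟨hha, ha⟩, b, ⟨⟨hhb, hb⟩, hab, eab⟩, c, ⟨⟨hhc, hc⟩, hbc, ebc⟩, h⟩ := h
  rcases h with ⟨⟨hca, eca⟩, h⟩ | ⟨hac, d, ⟨⟨⟨⟨hhd, hd⟩, hcd, ecd⟩, hda, eda⟩, hbd⟩, h⟩
  · refine exists_isWheel (m := 2) (Or.inl rfl) (h := o) (v := ![a, b, c]) ?_ ?_ ?_
      (fun x _ y _ z _ => hnc x y z) (hcov (fun w => ?_) h)
    · intro i j
      fin_cases i <;> fin_cases j <;> simp [hab, hbc, hca, hab.symm, hbc.symm, hca.symm]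
    · intro i
      fin_cases i
      exacts [⟨hha, ha⟩, ⟨hhb, hb⟩, ⟨hhc, hc⟩]
    · intro i
      fin_cases i
      exacts [eab, ebc, eca]
    · simp [wheelSet, eq_comm]
      tauto
  · refine exists_isWheel (m := 3) (Or.inr rfl) (h := o) (v := ![a, b, c, d]) ?_ ?_ ?_
      (fun x _ y _ z _ => hnc x y z) (hcov (fun w => ?_) h)
    · intro i j
      fin_cases i <;> fin_cases j <;> simp [hab, hbc, hcd, hda, hac, hbd, hab.symm, hbc.symm,
        hcd.symm, hda.symm, hac.symm, hbd.symm]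
    · intro i
      fin_cases i
      exacts [⟨hha, ha⟩, ⟨hhb, hb⟩, ⟨hhc, hc⟩, ⟨hhd, hd⟩]
    · intro i
      fin_cases i
      exacts [eab, ebc, ecd, eda]
    · simp [wheelSet, eq_comm]
      tauto

theorem IsAbsorbingPattern.three_le_card_even_ne {no : ℕ} (h : IsAbsorbingPattern ν no)
    (v : Fin n) (i : Fin 5) :
    3 ≤ (Finset.univ.filter fun j => Even (classCard ν v j) ∧ j ≠ i).card +
      (if Even (classCard ν v i) then 1 else 0) := by
  have h1 := h.three_le_card_even v
  have h2 : (Finset.univ.filter fun j => Even (classCard ν v j) ∧ j ≠ i) =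
      (Finset.univ.filter fun j => Even (classCard ν v j)).erase i := by
    ext j
    simp [and_comm]
  rw [h2]
  split_ifs with hi
  · rw [Finset.card_erase_of_mem (by simpa using hi)]
    omega
  · rw [Finset.erase_eq_of_notMem (by simpa using hi)]
    omega

/-- If the other even check nodes of a vertex `v` on a check node `ℓ` exhaust the vertices outside
`ℓ`, then `v` shares a different check node with each of the latter. -/
theorem NoFourCycle.exists_join (hν : NoFourCycle ν) {v : Fin n} {i : Fin 5}
    (hc : n - classCard ν v i ≤
      (Finset.univ.filter fun j => Even (classCard ν v j) ∧ j ≠ i).card)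
    {d : Fin n} (hd : ν d i ≠ ν v i) :
    ∃ j, ν v j = ν d j ∧ ∀ e, ν e i ≠ ν v i → ν v j = ν e j → e = d := by
  obtain ⟨f, hf, hinj⟩ := hν.exists_injOn v
  have h1 : (Finset.univ.filter fun w => ¬ ν w i = ν v i).card = n - classCard ν v i := by
    have := Finset.card_filter_add_card_filter_not (s := (Finset.univ : Finset (Fin n)))
      (fun w => ν w i = ν v i)
    rw [Finset.card_univ, Fintype.card_fin] at this
    unfold classCard
    omega
  have hsurj : ∀ e, ν e i ≠ ν v i → ∃ j, Even (classCard ν v j) ∧ f j = e := by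
    intro e he
    have := Finset.surjOn_of_injOn_of_card_le
      (s := Finset.univ.filter fun j => Even (classCard ν v j) ∧ j ≠ i)
      (t := Finset.univ.filter fun w => ¬ ν w i = ν v i) f ?_ ?_ (h1.le.trans hc)
    · obtain ⟨j, hj, rfl⟩ := this (by simpa using he)
      have hj : Even (classCard ν v j) ∧ j ≠ i := by simpa using hj
      exact ⟨j, hj.1, rfl⟩
    · intro j hj
      have hj : Even (classCard ν v j) ∧ j ≠ i := by simpa using hj
      simp only [Finset.coe_filter, Finset.mem_univ, true_and, Set.mem_ofPred_eq]
      intro h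
      exact hj.2 (hν _ _ (hf j hj.1).1 _ _ (hf j hj.1).2 h)
    · refine hinj.mono fun j hj => ?_
      have hj : Even (classCard ν v j) ∧ j ≠ i := by simpa using hj
      exact hj.1
  obtain ⟨j, hj, rfl⟩ := hsurj d hd
  refine ⟨j, (hf j hj).2.symm, fun e he hej => ?_⟩
  obtain ⟨j', hj', rfl⟩ := hsurj e he
  rw [hν _ _ (hf j' hj').1 _ _ (hf j' hj').2 hej.symm]

/-- With a check node of degree at least three, the count of even check nodes is tight: each vertex
on it is joined to every vertex off it, through different check nodes. Two vertices `a`, `b` on it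
and two adjacent vertices `d`, `e` off it then form a wheel with three spokes. -/
theorem hasWheel_of_three_le_classCard {ν : Fin 6 → Fin 5 → X} (hν : NoFourCycle ν)
    (h : IsAbsorbingPattern ν 8) {a : Fin 6} {i : Fin 5} (hi : 3 ≤ classCard ν a i) :
    HasWheel ν := by
  have hline : ∀ w, ν w i = ν a i → classCard ν w i = classCard ν a i := by
    intro w hw
    simp only [classCard, hw]
  have hle : classCard ν a i ≤ 6 := (Finset.card_filter_le _ _).trans (by simp)
  have h1 := h.three_le_card_even_ne a i
  have h2 := hν.card_even_ne_le a i
  have h34 : classCard ν a i = 3 ∨ classCard ν a i = 4 := by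
    generalize classCard ν a i = c at *
    interval_cases c
    · simp
    · simp
    · rw [if_neg (by decide)] at h1
      omega
    · rw [if_pos (by decide)] at h1
      omega
  have hjoin : ∀ w, ν w i = ν a i → ∀ d, ν d i ≠ ν a i →
      ∃ j, ν w j = ν d j ∧ ∀ e, ν e i ≠ ν a i → ν w j = ν e j → e = d := by
    intro w hw d hd
    rw [← hw] at hd ⊢
    refine hν.exists_join ?_ hd
    have h3 := h.three_le_card_even_ne w i
    rw [hline w hw] at h3 ⊢
    rcases h34 with h34 | h34 <;> rw [h34] at h3 ⊢
    · rw [if_neg (by decide)] at h3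
      omega
    · rw [if_pos (by decide)] at h3
      omega
  obtain ⟨b, hba, hb⟩ := exists_ne_of_one_lt_classCard (lt_of_lt_of_le (by norm_num) hi)
  -- two vertices outside the check node share a check node
  obtain ⟨d, e, hd, he, hde, k, hk⟩ : ∃ d e, ν d i ≠ ν a i ∧ ν e i ≠ ν a i ∧ d ≠ e ∧
      ∃ k, ν d k = ν e k := by
    by_contra hcon
    -- Degree three would need 25 ordered adjacent pairs with only 24 available; degree four would
    -- need 30 with only 28 available.
    have h3 := h.le_card_adj hν a i
    have h4 : (Finset.univ.filter fun w => ¬ ν w i = ν a i).card = 6 - classCard ν a i := by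
      have := Finset.card_filter_add_card_filter_not (s := (Finset.univ : Finset (Fin 6)))
        (fun w => ν w i = ν a i)
      rw [Finset.card_univ, Fintype.card_fin] at this
      unfold classCard
      omega
    have h5 := Finset.card_union_of_disjoint (s := Finset.univ.filter fun e : Fin 6 × Fin 6 =>
      adjBool ν e.1 e.2 = true) (t := (Finset.univ.filter fun w => ¬ ν w i = ν a i).offDiag) (by
        rw [Finset.disjoint_left]
        rintro ⟨d, e⟩ h5 h6
        simp only [Finset.mem_filter, Finset.mem_univ, true_and, adjBool_eq_true,
          Finset.mem_offDiag] at h5 h6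
        exact hcon ⟨d, e, h6.1, h6.2.1, h5⟩)
    have h6 := Finset.card_le_card (s := (Finset.univ.filter fun e : Fin 6 × Fin 6 =>
      adjBool ν e.1 e.2 = true) ∪ (Finset.univ.filter fun w => ¬ ν w i = ν a i).offDiag)
      (t := (Finset.univ : Finset (Fin 6)).offDiag) (by
        rintro ⟨d, e⟩ h6
        simp only [Finset.mem_union, Finset.mem_filter, Finset.mem_univ, true_and,
          adjBool_eq_true, Finset.mem_offDiag] at h6 ⊢
        rcases h6 with h6 | h6
        exacts [h6.1, h6.2.2])
    rw [Finset.offDiag_card, Finset.card_univ, Fintype.card_fin, h5, Finset.offDiag_card, h4] at h6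
    rcases h34 with h34 | h34 <;> rw [h34] at h3 h6 <;> omega
  obtain ⟨jad, had, hjad⟩ := hjoin a rfl d hd
  obtain ⟨jae, hae, hjae⟩ := hjoin a rfl e he
  obtain ⟨jbd, hbd, hjbd⟩ := hjoin b hb d hd
  obtain ⟨jbe, hbe, hjbe⟩ := hjoin b hb e he
  have hda : d ≠ a := fun h => hd (h ▸ rfl)
  have hea : e ≠ a := fun h => he (h ▸ rfl)
  have hdb : d ≠ b := fun h => hd (h ▸ hb)
  have heb : e ≠ b := fun h => he (h ▸ hb)
  have nc1 : ∀ x, ν x i ≠ ν a i → ∀ j, ν a j = ν b j → ν b j ≠ ν x j := by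
    intro x hx j h1 h2
    obtain rfl := hν b a hba i j hb h1.symm
    exact hx (h2.symm.trans hb)
  have nc2 : ∀ w, ν w i = ν a i → d ≠ w → ∀ j, ν w j = ν d j → ν d j ≠ ν e j := by
    intro w hw hdw j h1 h2
    obtain ⟨j', h3, h4⟩ := hjoin w hw d hd
    obtain rfl := hν d w hdw j j' h1.symm h3.symm
    exact hde (h4 e he (h1.trans h2)).symm
  have hset : ∀ x, x ∈ wheelSet a ![b, d, e] ↔ x = a ∨ x = b ∨ x = d ∨ x = e := by
    intro x
    simp [wheelSet, eq_comm]
    tauto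
  have nc1d := nc1 d hd
  have nc1e := nc1 e he
  have nc2a := nc2 a rfl hda
  have nc2b := nc2 b hb hdb
  refine exists_isWheel (m := 2) (Or.inl rfl) (h := a) (v := ![b, d, e]) ?_ ?_ ?_ ?_ ?_
  · intro i j
    fin_cases i <;> fin_cases j <;> simp [hdb, heb, hde, hdb.symm, heb.symm, hde.symm]
  · intro j
    fin_cases j
    exacts [⟨hba.symm, i, hb.symm⟩, ⟨hda.symm, jad, had⟩, ⟨hea.symm, jae, hae⟩]
  · intro j
    fin_cases j
    exacts [⟨jbd, hbd⟩, ⟨k, hk⟩, ⟨jbe, hbe.symm⟩]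
  · intro x hx y hy z hz hxy hyz hxz j h1 h2
    rw [hset] at hx hy hz
    have e1 := nc1d j
    have e2 := nc1e j
    have e3 := nc2a j
    have e4 := nc2b j
    clear nc1 nc2 nc1d nc1e nc2a nc2b hjoin hline hjad hjae hjbd hjbe hset
    rcases hx with rfl | rfl | rfl | rfl <;> rcases hy with rfl | rfl | rfl | rfl <;>
      first
        | exact absurd rfl hxy
        | (rcases hz with rfl | rfl | rfl | rfl <;>
            first
              | exact absurd rfl hyz
              | exact absurd rfl hxz
              | grind)
  · intro x
    simp only [hset]
    right
    by_cases hx : ν x i = ν a i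
    · obtain ⟨j, hj, -⟩ := hjoin x hx d hd
      refine ⟨a, Or.inl rfl, d, Or.inr (Or.inr (Or.inl rfl)), i, j, jad, ?_, hx, hj, had⟩
      rintro rfl
      exact hd (hj.symm.trans hx)
    · obtain ⟨j, hj, -⟩ := hjoin a rfl x hx
      obtain ⟨j', hj', -⟩ := hjoin b hb x hx
      refine ⟨a, Or.inl rfl, b, Or.inr (Or.inl rfl), j, j', i, ?_, hj.symm, hj'.symm, hb.symm⟩
      rintro rfl
      exact nc1 x hx j (hj.trans hj'.symm) hj'

/-- Every `(4,8)`, `(5,9)` or `(6,8)` absorbing pattern without four-cycles contains a wheel. -/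
theorem IsAbsorbingPattern.hasWheel {no : ℕ} (hT : (n, no) ∈ targetParams)
    (h : IsAbsorbingPattern ν no) (hν : NoFourCycle ν) : HasWheel ν := by
  by_cases hcls : ∀ v i, classCard ν v i ≤ 2
  · have hpos : 0 < n := by
      simp only [targetParams, List.mem_cons, Prod.mk.injEq, List.not_mem_nil, or_false] at hT
      omega
    -- Only the bound of `5 * n - no` on ordered adjacent pairs matters here, so any check node
    -- serves.
    have h1 := h.le_card_adj hν ⟨0, hpos⟩ 0
    have h2 := card_adj_add_card_nonAdj ν
    apply hasWheel_of_hasWheelBool hcls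
    refine hasWheelBool_of_card (m := (n * n + no - 6 * n) / 2) ?_ adjBool_comm
      (fun u => by simp [adjBool]) (h.card_nonNeighbours_le hν) ?_
    · simp only [targetParams, List.mem_cons, Prod.mk.injEq, List.not_mem_nil, or_false] at hT
      rcases hT with ⟨rfl, rfl⟩ | ⟨rfl, rfl⟩ | ⟨rfl, rfl⟩ <;> decide
    · simp only [targetParams, List.mem_cons, Prod.mk.injEq, List.not_mem_nil, or_false] at hT
      rcases hT with ⟨rfl, rfl⟩ | ⟨rfl, rfl⟩ | ⟨rfl, rfl⟩ <;> omega
  · push Not at hcls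
    obtain ⟨v, i, hvi⟩ := hcls
    have hle : classCard ν v i ≤ n := (Finset.card_filter_le _ _).trans (by simp)
    have h1 := h.three_le_card_even_ne v i
    have h2 := hν.card_even_ne_le v i
    simp only [targetParams, List.mem_cons, Prod.mk.injEq, List.not_mem_nil, or_false] at hT
    rcases hT with ⟨rfl, rfl⟩ | ⟨rfl, rfl⟩ | ⟨rfl, rfl⟩
    -- On four or five vertices, a check node of degree at least three leaves too few other
    -- neighbours for three even check nodes.
    · split_ifs at h1 <;> omega
    · split_ifs at h1 with h3
      · have : classCard ν v i ≠ 3 := fun h4 => by rw [h4] at h3; exact absurd h3 (by decide)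
        omega
      · omega
    · exact hasWheel_of_three_le_classCard hν h hvi

end PatternWheel

/-! ### Rigidity for the tabulated row-selection functions -/

section Resonance

variable {R : Type} [CommRing R]

/-- The labels of the edges of a wheel never satisfy the relation under which the wheel has a
nonconstant realization. -/
structure NonResonant (a : Fin 5 → R) : Prop where
  injective : Function.Injective a
  three : ∀ s r : Fin 3 → Fin 5, Function.Injective s → (∀ i, r i ≠ s i) →
    (∀ i, r i ≠ s (i + 1)) → (∀ i, r i ≠ r (i + 1)) →
    ∏ i, (a (r i) - a (s i)) ≠ ∏ i, (a (r i) - a (s (i + 1)))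
  four : ∀ s r : Fin 4 → Fin 5, Function.Injective s → (∀ i, r i ≠ s i) →
    (∀ i, r i ≠ s (i + 1)) → (∀ i, r i ≠ r (i + 1)) →
    ∏ i, (a (r i) - a (s i)) ≠ ∏ i, (a (r i) - a (s (i + 1)))

/-- Multiplying the relations around the rim shows that `X 0` is killed by the difference of the two
products. Its vanishing then propagates along the rim because distinct row groups have distinct
labels. -/
theorem NonResonant.eq_zero [IsDomain R] {a : Fin 5 → R} (ha : NonResonant a) {m : ℕ}
    (hm : m = 2 ∨ m = 3) {s r : Fin (m + 1) → Fin 5} (hs : Function.Injective s)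
    (h1 : ∀ i, r i ≠ s i) (h2 : ∀ i, r i ≠ s (i + 1)) (h3 : ∀ i, r i ≠ r (i + 1))
    {X : Fin (m + 1) → R}
    (hX : ∀ i, (a (r i) - a (s i)) * X i = (a (r i) - a (s (i + 1))) * X (i + 1)) (i : Fin (m + 1)) :
    X i = 0 := by
  have step : ∀ i, X i = 0 → X (i + 1) = 0 := by
    intro i hi
    have := hX i
    rw [hi, mul_zero, eq_comm] at this
    exact (mul_eq_zero.1 this).resolve_left (sub_ne_zero.2 fun h => h2 i (ha.injective h))
  have h0 : X 0 = 0 := by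
    rcases hm with rfl | rfl
    · have hne := ha.three s r hs h1 h2 h3
      have e0 := hX 0
      have e1 := hX 1
      have e2 := hX 2
      simp only [Fin.prod_univ_three] at hne
      simp only [Fin.isValue, zero_add, Fin.reduceAdd] at e0 e1 e2 hne
      refine (mul_eq_zero.1 ?_).resolve_left (sub_ne_zero.2 hne)
      linear_combination (a (r 1) - a (s 1)) * (a (r 2) - a (s 2)) * e0 +
        (a (r 0) - a (s 1)) * (a (r 2) - a (s 2)) * e1 +
        (a (r 0) - a (s 1)) * (a (r 1) - a (s 2)) * e2
    · have hne := ha.four s r hs h1 h2 h3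
      have e0 := hX 0
      have e1 := hX 1
      have e2 := hX 2
      have e3 := hX 3
      simp only [Fin.prod_univ_four] at hne
      simp only [Fin.isValue, zero_add, Fin.reduceAdd] at e0 e1 e2 e3 hne
      refine (mul_eq_zero.1 ?_).resolve_left (sub_ne_zero.2 hne)
      linear_combination
        (a (r 1) - a (s 1)) * (a (r 2) - a (s 2)) * (a (r 3) - a (s 3)) * e0 +
        (a (r 0) - a (s 1)) * (a (r 2) - a (s 2)) * (a (r 3) - a (s 3)) * e1 +
        (a (r 0) - a (s 1)) * (a (r 1) - a (s 2)) * (a (r 3) - a (s 3)) * e2 +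
        (a (r 0) - a (s 1)) * (a (r 1) - a (s 2)) * (a (r 2) - a (s 3)) * e3
  induction i using Fin.induction with
  | zero => exact h0
  | succ i ih => rw [← Fin.coeSucc_eq_succ]; exact step _ ih

/-- Nonresonance makes `u` constant on the wheel. A covered vertex `x` forms a triangle with two
wheel vertices, whose equation reduces to `(a b - a c) * (u h - u x) = 0`, so the constant extends
to `x`. -/
theorem NonResonant.relevantDetsNonzero [IsDomain R] {a : Fin 5 → R} (ha : NonResonant a) :
    RelevantDetsNonzero a := by
  rw [relevantDetsNonzero_iff]
  intro T hT G hG u hu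
  rw [G.isAbsorbingSet_iff] at hG
  obtain ⟨m, hm, h, v, s, r, hw⟩ := hG.hasWheel hT G.no_four_cycle
  have h1 : ∀ i : Fin (m + 1), i + 1 ≠ i := by rcases hm with rfl | rfl <;> decide
  have hX := ha.eq_zero hm hw.spoke_injective hw.rim_ne_left hw.rim_ne_right hw.rim_ne_rim
    (X := fun i => LabelledGraph.extend u (v i) - LabelledGraph.extend u h) (fun i => by
      have := LabelledGraph.triangle_equation (a := a) hu (hw.hub_ne i)
        (fun h => h1 i (hw.rim_injective h).symm) (hw.hub_ne (i + 1)) (hw.hub i) (hw.rim i)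
        (hw.hub (i + 1)) (fun h => h1 i (hw.spoke_injective h).symm) (hw.rim_ne_left i).symm
        (hw.rim_ne_right i).symm
      linear_combination -this)
  have hwheel : ∀ x ∈ wheelSet h v, LabelledGraph.extend u x = LabelledGraph.extend u h := by
    rintro x (rfl | ⟨i, rfl⟩)
    · rfl
    · exact sub_eq_zero.1 (hX i)
  have hall : ∀ x, LabelledGraph.extend u x = LabelledGraph.extend u h := by
    intro x
    by_cases hx : x ∈ wheelSet h v
    · exact hwheel x hx
    obtain ⟨y, hy, z, hz, b, c, d, hbc, hb, hc, hd⟩ := (hw.cover x).resolve_left hx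
    have hxy : x ≠ y := fun h => hx (h ▸ hy)
    have hxz : x ≠ z := fun h => hx (h ▸ hz)
    have hyz : y ≠ z := by
      rintro rfl
      exact hbc (G.no_four_cycle x y hxy b c hb hc)
    have hbd : b ≠ d := by
      rintro rfl
      exact hbc (G.no_four_cycle x z hxz b c (hb.trans hd) hc)
    have hcd : c ≠ d := by
      rintro rfl
      exact hbc (G.no_four_cycle x y hxy b c hb (hc.trans hd.symm))
    have := LabelledGraph.triangle_equation (a := a) hu hxy hyz hxz hb hd hc hbc hbd hcd
    rw [hwheel y hy, hwheel z hz] at this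
    have h2 : (a b - a c) * (LabelledGraph.extend u h - LabelledGraph.extend u x) = 0 := by
      linear_combination this
    exact (sub_eq_zero.1 ((mul_eq_zero.1 h2).resolve_left
      (sub_ne_zero.2 fun h => hbc (ha.injective h)))).symm
  exact LabelledGraph.eq_zero_of_extend_const fun x y => (hall x).trans (hall y).symm

end Resonance

/-! ### Nonresonance of the tabulated labels as a finite check on residues. -/

/-- The difference of two labels modulo `p`. -/
def labelSub (p : ℕ) (g : Fin 5 → ℕ) (i j : Fin 5) : ℕ := g i + p - g j

theorem natCast_labelSub {p : ℕ} {g : Fin 5 → ℕ} (hp : ∀ i, g i < p) (i j : Fin 5) :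
    (labelSub p g i j : ZMod p) = (g i : ZMod p) - g j := by
  rw [labelSub, Nat.cast_sub (by have := hp j; omega), Nat.cast_add, ZMod.natCast_self, add_zero]

/-- A decidable form of nonresonance for residues. -/
def ResidueNonResonant (p : ℕ) (g : Fin 5 → ℕ) : Prop :=
  (∀ s₀ s₁ : Fin 5, s₁ ≠ s₀ → ∀ s₂ : Fin 5, s₂ ≠ s₀ ∧ s₂ ≠ s₁ →
    ∀ r₀ : Fin 5, r₀ ≠ s₀ ∧ r₀ ≠ s₁ → ∀ r₁ : Fin 5, r₁ ≠ s₁ ∧ r₁ ≠ s₂ ∧ r₀ ≠ r₁ →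
    ∀ r₂ : Fin 5, r₂ ≠ s₂ ∧ r₂ ≠ s₀ ∧ r₁ ≠ r₂ ∧ r₂ ≠ r₀ →
    labelSub p g r₀ s₀ * labelSub p g r₁ s₁ * labelSub p g r₂ s₂ % p ≠
      labelSub p g r₀ s₁ * labelSub p g r₁ s₂ * labelSub p g r₂ s₀ % p) ∧
  (∀ s₀ s₁ : Fin 5, s₁ ≠ s₀ → ∀ s₂ : Fin 5, s₂ ≠ s₀ ∧ s₂ ≠ s₁ →
    ∀ s₃ : Fin 5, s₃ ≠ s₀ ∧ s₃ ≠ s₁ ∧ s₃ ≠ s₂ →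
    ∀ r₀ : Fin 5, r₀ ≠ s₀ ∧ r₀ ≠ s₁ → ∀ r₁ : Fin 5, r₁ ≠ s₁ ∧ r₁ ≠ s₂ ∧ r₀ ≠ r₁ →
    ∀ r₂ : Fin 5, r₂ ≠ s₂ ∧ r₂ ≠ s₃ ∧ r₁ ≠ r₂ →
    ∀ r₃ : Fin 5, r₃ ≠ s₃ ∧ r₃ ≠ s₀ ∧ r₂ ≠ r₃ ∧ r₃ ≠ r₀ →
    labelSub p g r₀ s₀ * labelSub p g r₁ s₁ * labelSub p g r₂ s₂ * labelSub p g r₃ s₃ % p ≠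
      labelSub p g r₀ s₁ * labelSub p g r₁ s₂ * labelSub p g r₂ s₃ * labelSub p g r₃ s₀ % p)

set_option synthInstance.maxHeartbeats 400000 in
set_option synthInstance.maxSize 2000 in
instance (p : ℕ) (g : Fin 5 → ℕ) : Decidable (ResidueNonResonant p g) := by
  unfold ResidueNonResonant
  refine @instDecidableAnd _ _ ?_ ?_ <;> infer_instance

theorem ResidueNonResonant.nonResonant {p : ℕ} {g : Fin 5 → ℕ} (hg : Function.Injective g)
    (hp : ∀ i, g i < p) (h : ResidueNonResonant p g) :
    NonResonant fun i => (g i : ZMod p) := by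
  refine ⟨natCast_comp_injective hg hp, fun s r hs h1 h2 h3 => ?_, fun s r hs h1 h2 h3 => ?_⟩
  · have := h.1 (s 0) (s 1) (hs.ne (by decide)) (s 2) ⟨hs.ne (by decide), hs.ne (by decide)⟩
      (r 0) ⟨h1 0, h2 0⟩ (r 1) ⟨h1 1, h2 1, h3 0⟩ (r 2) ⟨h1 2, h2 2, h3 1, h3 2⟩
    rw [Ne, ← ZMod.natCast_eq_natCast_iff'] at this
    simp only [Nat.cast_mul, natCast_labelSub hp] at this
    rw [Fin.prod_univ_three, Fin.prod_univ_three]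
    exact this
  · have := h.2 (s 0) (s 1) (hs.ne (by decide)) (s 2) ⟨hs.ne (by decide), hs.ne (by decide)⟩
      (s 3) ⟨hs.ne (by decide), hs.ne (by decide), hs.ne (by decide)⟩
      (r 0) ⟨h1 0, h2 0⟩ (r 1) ⟨h1 1, h2 1, h3 0⟩ (r 2) ⟨h1 2, h2 2, h3 1⟩
      (r 3) ⟨h1 3, h2 3, h3 2, h3 3⟩
    rw [Ne, ← ZMod.natCast_eq_natCast_iff'] at this
    simp only [Nat.cast_mul, natCast_labelSub hp] at this
    rw [Fin.prod_univ_four, Fin.prod_univ_four]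
    exact this

theorem residueNonResonant_table : ∀ e ∈ rsfTable, ResidueNonResonant e.1 e.2 := by
  decide +kernel

theorem rsfTable_spec : ∀ e ∈ rsfTable,
    Function.Injective e.2 ∧ (∀ i, e.2 i < e.1) ∧ e.1.Prime := by
  intro e he
  simp only [rsfTable, List.mem_cons, List.not_mem_nil, or_false] at he
  rcases he with rfl | rfl | rfl | rfl | rfl <;>
    exact ⟨by decide, by decide, by norm_num⟩

/-! ### The number of absorbing sets -/

/-! ### Upper bound: three parameters determine a configuration with given incidences. -/

section Upper

variable {n m : ℕ} {X Y : Type}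

/-- A realization of a wheel pattern is determined by the hub and one rim vertex. -/
theorem IsWheel.realization_unique {ℓ : Y → Fin 5 → X}
    (hℓ : ∀ P Q i j, i ≠ j → ℓ P i = ℓ Q i → ℓ P j = ℓ Q j → P = Q) {q q' : Fin n → Y}
    {h : Fin n} {v : Fin (m + 1) → Fin n} {s r : Fin (m + 1) → Fin 5}
    (hw : IsWheel (fun x => ℓ (q x)) h v s r)
    (hqq : ∀ x y i, ℓ (q x) i = ℓ (q y) i → ℓ (q' x) i = ℓ (q' y) i)
    (hh : q h = q' h) (h0 : q (v 0) = q' (v 0)) : q = q' := by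
  -- A node is recovered from its check nodes in two row groups, which it shares with nodes already
  -- known.
  have step : ∀ {x y z b c}, b ≠ c → ℓ (q x) b = ℓ (q y) b → ℓ (q x) c = ℓ (q z) c →
      q y = q' y → q z = q' z → q x = q' x := by
    intro x y z b c hbc hb hc hy hz
    refine hℓ _ _ b c hbc ?_ ?_
    · rw [hb, hqq _ _ _ hb, hy]
    · rw [hc, hqq _ _ _ hc, hz]
  have hv : ∀ i, q (v i) = q' (v i) := by
    intro i
    induction i using Fin.induction with
    | zero => exact h0
    | succ i ih =>
      rw [← Fin.coeSucc_eq_succ]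
      exact step (hw.rim_ne_right _) (hw.rim _).symm (hw.hub _).symm ih hh
  have hwheel : ∀ x ∈ wheelSet h v, q x = q' x := by
    rintro x (rfl | ⟨i, rfl⟩)
    exacts [hh, hv i]
  funext x
  rcases hw.cover x with hx | ⟨y, hy, z, hz, b, c, d, hbc, hb, hc, -⟩
  · exact hwheel x hx
  · exact step hbc hb hc (hwheel y hy) (hwheel z hz)

theorem numAbsorbingSets_srCode_le {no p : ℕ} [Fact p.Prime] (hT : (n, no) ∈ targetParams)
    {g : Fin 5 → ℕ} (hg : Function.Injective g) (hp : ∀ i, g i < p) :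
    numAbsorbingSets (srCode p g) n no ≤
      Fintype.card ((Fin n → Fin n → Fin 5 → Bool) × Fin n × Fin n) * p ^ 3 := by
  have hgp := natCast_comp_injective hg hp
  have hex : ∀ S : {S : Finset (Fin p × ZMod p) | IsAbsorbingSet (srCode p g) S n no},
      ∃ (q : Fin n ↪ Fin p × ZMod p) (h v : Fin n), Finset.univ.map q = S.1 ∧
        ∀ q' : Fin n → Fin p × ZMod p,
          (∀ x y i, codeLine g (q x) i = codeLine g (q y) i →
            codeLine g (q' x) i = codeLine g (q' y) i) →
          q h = q' h → (q v).1 = (q' v).1 → ⇑q = q' := by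
    rintro ⟨S, hS⟩
    have hS : IsAbsorbingSet (srCode p g) S n no := hS
    obtain ⟨q, rfl⟩ := hS.exists_embedding
    rw [isAbsorbingSet_map_iff (srCode_ne_zero g)] at hS
    obtain ⟨m, -, h, v, s, r, hw⟩ := hS.hasWheel hT (noFourCycle_codeLine hgp q)
    refine ⟨q, h, v 0, rfl, fun q' hqq hh h0 => ?_⟩
    refine hw.realization_unique (fun P Q i j hij => codeLine_injective hgp hij) hqq hh ?_
    have h1 := hw.hub 0
    have h2 := hqq _ _ _ h1
    rw [← hh, h1] at h2
    simp only [codeLine] at h2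
    rw [h0] at h2
    exact Prod.ext h0 (add_right_cancel h2)
  choose q h v hq huniq using hex
  -- A set is encoded by its incidences, the positions of hub and rim node, the hub itself and only
  -- the column group of the rim node: the shared check node supplies the other coordinate.
  let F : {S : Finset (Fin p × ZMod p) | IsAbsorbingSet (srCode p g) S n no} →
      ((Fin n → Fin n → Fin 5 → Bool) × Fin n × Fin n) × ((Fin p × ZMod p) × Fin p) := fun S =>
    ((fun x y i => decide (codeLine g (q S x) i = codeLine g (q S y) i), h S, v S),
      (q S (h S), (q S (v S)).1))
  have hF : Function.Injective F := by
    intro S S' hSS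
    simp only [F, Prod.mk.injEq] at hSS
    obtain ⟨⟨hpat, hh, hv⟩, hq1, hq2⟩ := hSS
    have : ⇑(q S) = q S' := by
      refine huniq S _ (fun x y i hxy => ?_) (by rw [hq1, hh]) (by rw [hq2, hv])
      have := congrFun (congrFun (congrFun hpat x) y) i
      simpa [hxy] using this
    apply Subtype.ext
    rw [← hq S, ← hq S', DFunLike.coe_injective this]
  have := Nat.card_le_card_of_injective F hF
  refine this.trans (le_of_eq ?_)
  rw [Nat.card_eq_fintype_card, Fintype.card_prod, Fintype.card_prod (Fin p × ZMod p),
    Fintype.card_prod (Fin p), ZMod.card, Fintype.card_fin]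
  ring

end Upper

/-! ### Lower bound: affine images of one configuration. -/

section Lower

variable {n : ℕ}

/-- The incidences of the points with the given coordinates in the array-based code. -/
def planePattern {R : Type} [CommRing R] (J K : Fin n → R) (x : Fin n) (i : Fin 5) : R :=
  K x + (i : ℕ) * J x

theorem planePattern_cast (p : ℕ) (J K : Fin n → ℤ) (x : Fin n) (i : Fin 5) :
    planePattern (fun x => (J x : ZMod p)) (fun x => (K x : ZMod p)) x i =
      (planePattern J K x i : ℤ) := by
  simp [planePattern]

/-- The column group with a given residue. -/
def residueFin (p : ℕ) [NeZero p] (x : ZMod p) : Fin p := ⟨x.val, x.val_lt⟩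

theorem natCast_residueFin {p : ℕ} [NeZero p] (x : ZMod p) :
    (((residueFin p x : Fin p) : ℕ) : ZMod p) = x := ZMod.natCast_zmod_val x

/-- Translates and multiples of an absorbing configuration are absorbing, so that there are of order
`p ^ 3` of them. -/
theorem le_numAbsorbingSets_eabCode {no p : ℕ} [Fact p.Prime] {J K : Fin n → ZMod p}
    (habs : IsAbsorbingPattern (planePattern J K) no)
    (hsep : ∀ x y, x ≠ y → ∃ i, planePattern J K x i ≠ planePattern J K y i) {a b : Fin n}
    (hab : a ≠ b) : p ^ 2 * (p - 1) ≤ n ^ 2 * numAbsorbingSets (eabCode p) n no := by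
  classical
  let g : Fin 5 → ℕ := fun i => (i : ℕ)
  -- Translation by `(z.1, z.2.1)` after dilation by the unit `z.2.2`; both permute the lines of
  -- each slope.
  let q : ZMod p × ZMod p × (ZMod p)ˣ → Fin n → Fin p × ZMod p := fun z x =>
    (residueFin p (z.1 + z.2.2 * J x), z.2.1 + z.2.2 * K x)
  have hline : ∀ z x i, codeLine g (q z x) i =
      (z.2.1 + (i : ℕ) * z.1) + z.2.2 * planePattern J K x i := by
    intro z x i
    simp only [codeLine, q, natCast_residueFin, planePattern, g]
    ring
  have hpat : ∀ z x y i, planePattern J K x i = planePattern J K y i ↔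
      codeLine g (q z x) i = codeLine g (q z y) i := by
    intro z x y i
    rw [hline, hline, add_right_inj, Units.mul_right_inj]
  have hinj : ∀ z, Function.Injective (q z) := by
    intro z x y hxy
    by_contra hne
    obtain ⟨i, hi⟩ := hsep x y hne
    exact hi ((hpat z x y i).2 (by rw [hxy]))
  have hS : ∀ z, IsAbsorbingSet (eabCode p) (Finset.univ.map ⟨q z, hinj z⟩) n no := by
    intro z
    rw [eabCode, isAbsorbingSet_map_iff (srCode_ne_zero _)]
    exact habs.congr (hpat z)
  have hJK : J a ≠ J b ∨ K a ≠ K b := by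
    by_contra! hcon
    obtain ⟨i, hi⟩ := hsep a b hab
    exact hi (by simp [planePattern, hcon])
  have hq : Function.Injective fun z => (q z a, q z b) := by
    rintro ⟨x, y, t⟩ ⟨x', y', t'⟩ h
    simp only [q, Prod.mk.injEq] at h
    obtain ⟨⟨h1, h2⟩, h3, h4⟩ := h
    have h1 := congrArg (fun j : Fin p => ((j : ℕ) : ZMod p)) h1
    have h3 := congrArg (fun j : Fin p => ((j : ℕ) : ZMod p)) h3
    simp only [natCast_residueFin] at h1 h3
    have ht : (t : ZMod p) = t' := by
      rcases hJK with hne | hne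
      · have : ((t : ZMod p) - t') * (J a - J b) = 0 := by linear_combination h1 - h3
        exact sub_eq_zero.1 ((mul_eq_zero.1 this).resolve_right (sub_ne_zero.2 hne))
      · have : ((t : ZMod p) - t') * (K a - K b) = 0 := by linear_combination h2 - h4
        exact sub_eq_zero.1 ((mul_eq_zero.1 this).resolve_right (sub_ne_zero.2 hne))
    rw [ht] at h1 h2
    rw [add_right_cancel h1, add_right_cancel h2, Units.ext ht]
  let f : ZMod p × ZMod p × (ZMod p)ˣ → Finset (Fin p × ZMod p) := fun z =>
    Finset.univ.map ⟨q z, hinj z⟩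
  -- The images of `a` and `b` determine the affine map, and both lie in `S`.
  have hfib : ∀ S ∈ Finset.univ.image f, (Finset.univ.filter fun z => f z = S).card ≤ n ^ 2 := by
    intro S hSf
    obtain ⟨z₀, -, rfl⟩ := Finset.mem_image.1 hSf
    have hcard : (f z₀).card = n := by simp [f]
    rw [sq, ← hcard, ← Finset.card_product]
    refine Finset.card_le_card_of_injOn (fun z => (q z a, q z b)) ?_ hq.injOn
    intro z hz
    have hz : f z = f z₀ := by simpa using hz
    simp only [Finset.coe_product, Set.mem_prod, Finset.mem_coe, ← hz]
    exact ⟨Finset.mem_map.2 ⟨a, Finset.mem_univ _, rfl⟩,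
      Finset.mem_map.2 ⟨b, Finset.mem_univ _, rfl⟩⟩
  have h1 := Finset.card_le_mul_card_image Finset.univ (n ^ 2) hfib
  have h2 : (Finset.univ.image f).card ≤ numAbsorbingSets (eabCode p) n no := by
    rw [numAbsorbingSets, ← Set.ncard_coe_finset]
    refine Set.ncard_le_ncard ?_ (Set.toFinite _)
    intro S hSf
    obtain ⟨z, -, rfl⟩ := Finset.mem_image.1 (Finset.mem_coe.1 hSf)
    exact hS z
  rw [Finset.card_univ, Fintype.card_prod, Fintype.card_prod, ZMod.card, ZMod.card_units] at h1
  calc p ^ 2 * (p - 1) = p * (p * (p - 1)) := by ring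
    _ ≤ _ := h1.trans (Nat.mul_le_mul_left _ h2)

/-- A divisor of `60 ^ 3` has no prime factors other than 2, 3 and 5. -/
theorem intCast_eq_zero_iff_of_dvd {p : ℕ} (hp : p.Prime) (h7 : 7 ≤ p) {z : ℤ}
    (hz : z = 0 ∨ z ∣ 60 ^ 3) : (z : ZMod p) = 0 ↔ z = 0 := by
  refine ⟨fun h => ?_, fun h => by simp [h]⟩
  rw [ZMod.intCast_zmod_eq_zero_iff_dvd] at h
  refine hz.resolve_right fun hz => ?_
  have h1 : p ∣ 60 ^ 3 := by exact_mod_cast h.trans hz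
  have h2 : p ∣ 2 ^ 2 * (3 * 5) := hp.dvd_of_dvd_pow h1
  rw [hp.dvd_mul, hp.dvd_mul] at h2
  rcases h2 with h2 | h2 | h2
  · have := Nat.le_of_dvd (by norm_num) (hp.dvd_of_dvd_pow h2)
    omega
  · have := Nat.le_of_dvd (by norm_num) h2
    omega
  · have := Nat.le_of_dvd (by norm_num) h2
    omega

/-- An absorbing configuration of integer points remains absorbing modulo `p` if no coincidence is
created. -/
theorem planePattern_mod {no p : ℕ} [Fact p.Prime] (h7 : 7 ≤ p) {J K : Fin n → ℤ}
    (habs : IsAbsorbingPattern (planePattern J K) no)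
    (hsep : ∀ x y, x ≠ y → ∃ i, planePattern J K x i ≠ planePattern J K y i)
    (hdvd : ∀ x y i, planePattern J K x i - planePattern J K y i = 0 ∨
      planePattern J K x i - planePattern J K y i ∣ 60 ^ 3) :
    ∃ J' K' : Fin n → ZMod p, IsAbsorbingPattern (planePattern J' K') no ∧
      ∀ x y, x ≠ y → ∃ i, planePattern J' K' x i ≠ planePattern J' K' y i := by
  have hiff : ∀ x y i, planePattern J K x i = planePattern J K y i ↔
      planePattern (fun x => (J x : ZMod p)) (fun x => (K x : ZMod p)) x i =
        planePattern (fun x => (J x : ZMod p)) (fun x => (K x : ZMod p)) y i := by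
    intro x y i
    rw [planePattern_cast, planePattern_cast, ← sub_eq_zero, ← sub_eq_zero (b := ((_ : ℤ) : ZMod p)),
      ← Int.cast_sub, intCast_eq_zero_iff_of_dvd Fact.out h7 (hdvd x y i)]
  refine ⟨_, _, habs.congr hiff, fun x y hxy => ?_⟩
  obtain ⟨i, hi⟩ := hsep x y hxy
  exact ⟨i, fun h => hi ((hiff x y i).2 h)⟩

/-- The five slopes exhaust `ZMod 5`, so two points share a check node exactly when their columns
differ. Columns of sizes 1, 1, 1, 1, then 2, 2, 1, then 3, 2, 1, with no three points on a
non-vertical line, leave 6, 8 and 11 such pairs. -/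
theorem exists_absorbing_planePattern_five {no : ℕ} (hT : (n, no) ∈ targetParams) :
    ∃ J K : Fin n → ZMod 5, IsAbsorbingPattern (planePattern J K) no ∧
      ∀ x y, x ≠ y → ∃ i, planePattern J K x i ≠ planePattern J K y i := by
  simp only [targetParams, List.mem_cons, Prod.mk.injEq, List.not_mem_nil, or_false] at hT
  rcases hT with ⟨rfl, rfl⟩ | ⟨rfl, rfl⟩ | ⟨rfl, rfl⟩
  · exact ⟨![0, 1, 2, 3], ![0, 0, 3, 4], by decide +kernel, by decide +kernel⟩
  · exact ⟨![0, 0, 1, 1, 2], ![0, 1, 0, 1, 3], by decide +kernel, by decide +kernel⟩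
  · exact ⟨![0, 0, 0, 1, 1, 3], ![0, 1, 2, 0, 1, 2], by decide +kernel, by decide +kernel⟩

/-- The array-based codes have `(4,8)`, `(5,9)` and `(6,8)` absorbing configurations for all primes
`p ≥ 5`. -/
theorem exists_absorbing_planePattern {no : ℕ} (hT : (n, no) ∈ targetParams) (p : ℕ)
    [hp : Fact p.Prime] (h5 : 5 ≤ p) :
    ∃ J K : Fin n → ZMod p, IsAbsorbingPattern (planePattern J K) no ∧
      ∀ x y, x ≠ y → ∃ i, planePattern J K x i ≠ planePattern J K y i := by
  rcases h5.eq_or_lt with rfl | h6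
  · exact exists_absorbing_planePattern_five hT
  · have h7 : 7 ≤ p := by
      rcases Nat.lt_or_ge p 7 with h | h
      · interval_cases p
        exact absurd hp.out (by norm_num)
      · exact h
    simp only [targetParams, List.mem_cons, Prod.mk.injEq, List.not_mem_nil, or_false] at hT
    rcases hT with ⟨rfl, rfl⟩ | ⟨rfl, rfl⟩ | ⟨rfl, rfl⟩
    -- Points of the parabola `K = J - J ^ 2`: those with first coordinates `x` and `y` share a
    -- check node in row group `i` iff `x + y = i + 1`, so all pairs do.
    · exact planePattern_mod h7 (J := ![0, 1, 2, 3]) (K := ![0, 0, -2, -6])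
        (by decide +kernel) (by decide +kernel) (by decide +kernel)
    -- Points of `K = 2 * J - J ^ 2`, with condition `x + y = i + 2`; only the sums 1 and 7 are
    -- missed.
    · exact planePattern_mod h7 (J := ![0, 1, 2, 3, 4]) (K := ![0, 1, 0, -3, -8])
        (by decide +kernel) (by decide +kernel) (by decide +kernel)
    -- A centrally symmetric configuration in which all pairs but those of a four-cycle share a
    -- check node.
    · exact planePattern_mod h7 (J := ![0, 1, 1, 2, 2, 3]) (K := ![0, -4, 0, -6, -2, -6])
        (by decide +kernel) (by decide +kernel) (by decide +kernel)

end Lower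

/-- The numbers of absorbing sets in the array-based codes are of order `p ^ 3`. -/
theorem numAbsorbingSets_eabCode_order {n no : ℕ} (hT : (n, no) ∈ targetParams) :
    ∃ c₁ c₂ : ℝ, 0 < c₁ ∧ c₁ ≤ c₂ ∧ ∀ (p : ℕ) [Fact p.Prime], 5 ≤ p →
      c₁ * (p : ℝ) ^ 3 ≤ (numAbsorbingSets (eabCode p) n no : ℝ) ∧
        (numAbsorbingSets (eabCode p) n no : ℝ) ≤ c₂ * (p : ℝ) ^ 3 := by
  have hn : 4 ≤ n := by
    simp only [targetParams, List.mem_cons, Prod.mk.injEq, List.not_mem_nil, or_false] at hT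
    omega
  have hn' : (4 : ℝ) ≤ n := by exact_mod_cast hn
  let N := Fintype.card ((Fin n → Fin n → Fin 5 → Bool) × Fin n × Fin n)
  have hN : 1 ≤ N := by
    have : Nonempty (Fin n) := ⟨⟨0, by omega⟩⟩
    exact Fintype.card_pos
  have hn2 : (1 : ℝ) ≤ 2 * n ^ 2 := by nlinarith
  -- The factor 2 absorbs `p - 1 ≥ p / 2`, and `n ^ 2` is the fibre bound.
  refine ⟨1 / (2 * n ^ 2), N, by positivity, ?_, fun p _ h5 => ⟨?_, ?_⟩⟩
  · refine le_trans ?_ (show (1 : ℝ) ≤ N by exact_mod_cast hN)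
    rw [div_le_one (by positivity)]
    exact hn2
  · obtain ⟨J, K, habs, hsep⟩ := exists_absorbing_planePattern hT p h5
    have h1 := le_numAbsorbingSets_eabCode habs hsep
      (a := ⟨0, by omega⟩) (b := ⟨1, by omega⟩) (by simp)
    have h2 : (p : ℝ) ^ 2 * ((p : ℝ) - 1) ≤ n ^ 2 * (numAbsorbingSets (eabCode p) n no : ℝ) := by
      have : ((p - 1 : ℕ) : ℝ) = (p : ℝ) - 1 := by
        rw [Nat.cast_sub (by omega), Nat.cast_one]
      rw [← this]
      exact_mod_cast h1
    have hp : (5 : ℝ) ≤ p := by exact_mod_cast h5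
    rw [div_mul_eq_mul_div, one_mul, div_le_iff₀ (by positivity)]
    have h3 : (0 : ℝ) ≤ (p : ℝ) ^ 2 * (p - 2) := mul_nonneg (sq_nonneg _) (by linarith)
    nlinarith
  · have h1 := numAbsorbingSets_srCode_le (p := p) hT (g := fun i => (i : ℕ)) Fin.val_injective
      fun i => lt_of_lt_of_le i.2 h5
    exact_mod_cast h1

theorem mainTheorem2 :
    -- the numbers of absorbing sets in the array-based codes are of order `p ^ 3`
    (∀ T ∈ targetParams, ∃ c₁ c₂ : ℝ, 0 < c₁ ∧ c₁ ≤ c₂ ∧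
      ∀ (p : ℕ) [Fact p.Prime], 5 ≤ p →
        c₁ * (p : ℝ) ^ 3 ≤ (numAbsorbingSets (eabCode p) T.1 T.2 : ℝ) ∧
          (numAbsorbingSets (eabCode p) T.1 T.2 : ℝ) ≤ c₂ * (p : ℝ) ^ 3) ∧
    -- the tabulated row-selection functions, over the integers and modulo the tabulated prime
    (∀ e ∈ rsfTable, Function.Injective e.2 ∧ (∀ i, e.2 i < e.1) ∧ e.1.Prime ∧
      RelevantDetsNonzero (fun i => (e.2 i : ℤ)) ∧
      ∀ [Fact e.1.Prime], RelevantDetsNonzero (fun i => (e.2 i : ZMod e.1)) ∧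
        PrecludesTargets (srCode e.1 e.2)) ∧
    -- nonzero integer determinants stay nonzero modulo every sufficiently large prime
    (∀ g : Fin 5 → ℕ, Function.Injective g → RelevantDetsNonzero (fun i => (g i : ℤ)) →
      ∃ P : ℕ, ∀ (p : ℕ) [Fact p.Prime], P ≤ p →
        (∀ i, g i < p) ∧ RelevantDetsNonzero (fun i => (g i : ZMod p)) ∧
          PrecludesTargets (srCode p g)) ∧
    -- nonzero determinants modulo `p` exclude the absorbing sets
    (∀ (p : ℕ) [Fact p.Prime] (g : Fin 5 → ℕ), Function.Injective g → (∀ i, g i < p) →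
      RelevantDetsNonzero (fun i => (g i : ZMod p)) → PrecludesTargets (srCode p g)) := by
  refine ⟨fun T hT => numAbsorbingSets_eabCode_order hT, fun e he => ?_, fun g hg h => ?_,
    fun p _ g hg hp h => h.precludesTargets hg hp⟩
  · obtain ⟨hg, hp, hprime⟩ := rsfTable_spec e he
    have hmod : ∀ [Fact e.1.Prime], RelevantDetsNonzero fun i => (e.2 i : ZMod e.1) :=
      ((residueNonResonant_table e he).nonResonant hg hp).relevantDetsNonzero
    refine ⟨hg, hp, hprime, ?_, ⟨hmod, hmod.precludesTargets hg hp⟩⟩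
    have : Fact e.1.Prime := ⟨hprime⟩
    exact RelevantDetsNonzero.of_mod_prime hmod
  · obtain ⟨P, hP⟩ := h.eventually_mod_prime
    -- The sum exceeds every `g i`, which makes `g` a row-selection function for `p`.
    refine ⟨P + ∑ i, (g i + 1), fun p _ hp => ?_⟩
    have hlt : ∀ i, g i < p := by
      intro i
      have := Finset.single_le_sum (f := fun i => g i + 1) (fun _ _ => Nat.zero_le _)
        (Finset.mem_univ i)
      omega
    have hmod := hP p (by omega)
    exact ⟨hlt, hmod, hmod.precludesTargets hg hlt⟩
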